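/- Let $\mathcal G$ be a connected, locally finite graph with countable vertex set, without loops or multiple edges, in which each edge $e$ is identified with an interval $[0,l_e]$ of finite positive length. Equip $\mathcal G$ with the geodesic distance (the infimum of lengths of paths consisting of finitely many intervals) and with the measure extending Lebesgue measure on the edges. Assume that the metric completion $\overline{\mathcal G}$ is compact and weakly connected, i.e. for any distinct $x,y\in\overline{\mathcal G}$ there are a finite set $W\subset\mathcal G$ and disjoint open sets $A\ni x$, $B\ni y$ with $\overline{\mathcal G}\setminus W=A\cup B$. Let $\partial\overline{\mathcal G}$ be the union of $\overline{\mathcal G}\setminus\mathcal G$ and the set of vertices with exactly one incident edge. Let $q:\mathcal G\to\mathbb R$ be integrable and strictly positive, and assume there are edge weights $\omega(e)>0$ with $\sum_e\omega(e)<\infty$ and $\int_{\mathcal G}(\omega^{-1}q)^2\,\omega<\infty$. A function $u$ on $\mathcal G$ is called $q$-harmonic if it is continuous at vertices, on each (closed) edge $u'$ is absolutely continuous with $u''=qu$ a.e., and at every vertex $v$ of degree at least $2$ the derivatives of $u$ along the incident edges, in the direction pointing out of $v$, sum to $0$. Let $\mathcal A$ be the set of continuous $\phi:\overline{\mathcal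 G}\to\mathbb R$ that are infinitely differentiable on the open edges and satisfy $\phi'=0$ outside a finite set of edges and in a neighborhood of each vertex. For continuous $U:\partial\overline{\mathcal G}\to\mathbb R$ and clopen $\Omega\subset\partial\overline{\mathcal G}$, the Dirichlet–Neumann function is $$\Lambda_q(U,\Omega)=\int_{\mathcal G}u\,L\phi,\qquad L\phi=-\phi''+q\phi,$$ where $u:\overline{\mathcal G}\to\mathbb R$ is the continuous extension of $U$ that is $q$-harmonic on $\mathcal G$, and $\phi\in\mathcal A$ equals $1$ on $\Omega$ and $0$ on $\partial\overline{\mathcal G}\setminus\Omega$. Proposition. If $U:\partial\overline{\mathcal G}\to\mathbb R$ is continuous, nonnegative, and somewhere positive, then the $q$-harmonic extension $u$ of $U$ exists, $uq$ is integrable over $\mathcal G$, and $$\Lambda_q(U,\partial\overline{\mathcal G})=\int_{\mathcal G}u\,q>0.$$ -/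

import Mathlib

open Set Filter Topology MeasureTheory

/-- A connected, locally finite (simple) graph on the vertex set `V` together with a positive
finite length for each edge. -/
structure MetricGraph (V : Type*) where
  graph : SimpleGraph V
  connected : graph.Connected
  locallyFinite : ∀ v, (graph.neighborSet v).Finite
  len : graph.edgeSet → ℝ
  len_pos : ∀ e, 0 < len e

namespace MetricGraph

variable {V : Type*} (M : MetricGraph V)

/-- The edges of the graph. -/
abbrev Edge : Type _ := M.graph.edgeSet

/-- The endpoint of `e` corresponding to `0` under the identification of `e` with `[0, len e]`
(the orientation is an arbitrary choice). -/
noncomputable def source (e : M.Edge) : V := (Quot.out e.1).1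

/-- The endpoint of `e` corresponding to `len e` under the identification of `e` with
`[0, len e]`. -/
noncomputable def target (e : M.Edge) : V := (Quot.out e.1).2

/-- The points of the metric graph: the vertices, and the interior points of the edges. -/
inductive Point
  | vertex (v : V) : Point
  | inner (e : M.Edge) (t : ℝ) (ht : t ∈ Ioo 0 (M.len e)) : Point

/-- The identification of `[0, len e]` with the closed edge `e`
(extended to `ℝ` by clamping the parameter). -/
noncomputable def edgePoint (e : M.Edge) (t : ℝ) : M.Point :=
  if h₀ : t ≤ 0 then .vertex (M.source e)
  else if h₁ : M.len e ≤ t then .vertex (M.target e)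
  else .inner e t ⟨not_le.1 h₀, not_le.1 h₁⟩

/-- `HasPath x y r`: there is a path from `x` to `y` of total length `r`, composed of finitely
many intervals, each contained in a closed edge. -/
inductive HasPath : M.Point → M.Point → ℝ → Prop
  | nil (x : M.Point) : HasPath x x 0
  | cons (e : M.Edge) (s t : ℝ) (hs : s ∈ Icc 0 (M.len e)) (ht : t ∈ Icc 0 (M.len e))
      (y : M.Point) (r : ℝ) (h : HasPath (M.edgePoint e t) y r) :
      HasPath (M.edgePoint e s) y (|s - t| + r)

/-- The geodesic distance: the infimum of the lengths of paths joining two points. -/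
noncomputable def geodesicDist (x y : M.Point) : ℝ := sInf {r | M.HasPath x y r}

section Metric

variable {M}

theorem HasPath.nonneg {x y : M.Point} {r : ℝ} (h : M.HasPath x y r) : 0 ≤ r := by
  induction h with
  | nil => exact le_rfl
  | cons e s t hs ht y r h ih => positivity

theorem HasPath.append {x y z : M.Point} {r r' : ℝ} (h : M.HasPath x y r)
    (h' : M.HasPath y z r') : M.HasPath x z (r + r') := by
  induction h with
  | nil => simpa using h'
  | cons e s t hs ht y r h ih =>
    rw [add_assoc]
    exact .cons e s t hs ht _ _ (ih h')

theorem HasPath.single (e : M.Edge) {s t : ℝ} (hs : s ∈ Icc 0 (M.len e))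
    (ht : t ∈ Icc 0 (M.len e)) : M.HasPath (M.edgePoint e s) (M.edgePoint e t) |s - t| := by
  simpa using HasPath.cons e s t hs ht _ _ (.nil (M.edgePoint e t))

theorem HasPath.symm {x y : M.Point} {r : ℝ} (h : M.HasPath x y r) : M.HasPath y x r := by
  induction h with
  | nil => exact .nil _
  | cons e s t hs ht y r h ih =>
    rw [add_comm, abs_sub_comm]
    exact ih.append (.single e ht hs)

theorem edgePoint_zero (e : M.Edge) : M.edgePoint e 0 = .vertex (M.source e) := by
  simp [edgePoint]

theorem edgePoint_len (e : M.Edge) : M.edgePoint e (M.len e) = .vertex (M.target e) := by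
  have := M.len_pos e
  simp [edgePoint, not_le.2 this]

theorem edgePoint_inner (e : M.Edge) (t : ℝ) (ht : t ∈ Ioo 0 (M.len e)) :
    M.edgePoint e t = .inner e t ht := by
  simp [edgePoint, not_le.2 ht.1, not_le.2 ht.2]

theorem mk_source_target (e : M.Edge) : s(M.source e, M.target e) = e.1 :=
  Quot.out_eq e.1

theorem exists_hasPath_vertex (u v : V) : ∃ r, M.HasPath (.vertex u) (.vertex v) r := by
  obtain ⟨p⟩ := M.connected.preconnected u v
  induction p with
  | nil => exact ⟨0, .nil _⟩
  | @cons u w v h p ih =>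
    obtain ⟨r, hr⟩ := ih
    let e : M.Edge := ⟨s(u, w), h⟩
    have hp : M.HasPath (.vertex (M.source e)) (.vertex (M.target e)) |0 - M.len e| := by
      rw [← edgePoint_zero, ← edgePoint_len]
      exact .single e ⟨le_rfl, (M.len_pos e).le⟩ ⟨(M.len_pos e).le, le_rfl⟩
    have he : s(M.source e, M.target e) = s(u, w) := mk_source_target e
    rcases Sym2.eq_iff.1 he with ⟨h1, h2⟩ | ⟨h1, h2⟩
    · rw [h1, h2] at hp
      exact ⟨_, hp.append hr⟩
    · rw [h1, h2] at hp
      exact ⟨_, hp.symm.append hr⟩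

theorem exists_hasPath (x y : M.Point) : ∃ r, M.HasPath x y r := by
  have key : ∀ x : M.Point, ∃ v r, M.HasPath x (.vertex v) r := by
    rintro (v | ⟨e, t, ht⟩)
    · exact ⟨v, 0, .nil _⟩
    · refine ⟨M.source e, |t - 0|, ?_⟩
      rw [← edgePoint_zero, ← edgePoint_inner]
      exact .single e ⟨ht.1.le, ht.2.le⟩ ⟨le_rfl, (M.len_pos e).le⟩
  obtain ⟨u, r, hr⟩ := key x
  obtain ⟨v, r', hr'⟩ := key y
  obtain ⟨r'', h⟩ := exists_hasPath_vertex (M := M) u v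
  exact ⟨_, (hr.append h).append hr'.symm⟩

theorem bddBelow_hasPath (x y : M.Point) : BddBelow {r | M.HasPath x y r} :=
  ⟨0, fun _ hr => hr.nonneg⟩

end Metric

/-- The metric graph with its geodesic distance.  By local finiteness distinct points have
positive distance, so this is in fact a metric. -/
noncomputable instance : PseudoMetricSpace M.Point where
  dist := M.geodesicDist
  dist_self x := le_antisymm (csInf_le (bddBelow_hasPath x x) (.nil x))
    (Real.sInf_nonneg fun _ hr => hr.nonneg)
  dist_comm x y := by
    have : {r | M.HasPath x y r} = {r | M.HasPath y x r} :=
      Set.ext fun r => ⟨HasPath.symm, HasPath.symm⟩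
    simp only [geodesicDist, this]
  dist_triangle x y z := by
    refine le_of_forall_pos_le_add fun ε hε => ?_
    obtain ⟨r, hr, hr'⟩ := Real.lt_sInf_add_pos (exists_hasPath x y) (half_pos hε)
    obtain ⟨s, hs, hs'⟩ := Real.lt_sInf_add_pos (exists_hasPath y z) (half_pos hε)
    change r < sInf {r | M.HasPath x y r} + ε / 2 at hr'
    change s < sInf {r | M.HasPath y z r} + ε / 2 at hs'
    have h : sInf {r | M.HasPath x z r} ≤ r + s :=
      csInf_le (bddBelow_hasPath x z) (HasPath.append hr hs)
    simp only [geodesicDist]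
    linarith

theorem dist_edgePoint_le (e : M.Edge) (s t : ℝ) :
    dist (M.edgePoint e s) (M.edgePoint e t) ≤ |s - t| := by
  have hl := M.len_pos e
  have hc : ∀ t, M.edgePoint e t = M.edgePoint e (max 0 (min t (M.len e))) := by
    intro t
    rcases le_or_gt t 0 with h | h
    · rw [min_eq_left (h.trans hl.le), max_eq_left h]
      simp [edgePoint, h]
    · rcases le_or_gt (M.len e) t with h' | h'
      · rw [min_eq_right h', max_eq_right hl.le]
        simp [edgePoint, not_le.2 h, h', not_le.2 hl]
      · rw [min_eq_left h'.le, max_eq_right h.le]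
  have hm : ∀ t, max 0 (min t (M.len e)) ∈ Icc 0 (M.len e) := fun t =>
    ⟨le_max_left _ _, max_le hl.le (min_le_right _ _)⟩
  rw [hc s, hc t]
  refine (csInf_le (bddBelow_hasPath _ _) (HasPath.single e (hm s) (hm t))).trans ?_
  refine (abs_max_sub_max_le_max _ _ _ _).trans ?_
  refine max_le (by simp) ((abs_min_sub_min_le_max _ _ _ _).trans (max_le le_rfl (by simp)))

theorem continuous_edgePoint (e : M.Edge) : Continuous (M.edgePoint e) := by
  refine (LipschitzWith.of_dist_le_mul (K := 1) fun s t => ?_).continuous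
  simpa [Real.dist_eq] using M.dist_edgePoint_le e s t

/-- The metric completion of the metric graph. -/
abbrev Compl := UniformSpace.Completion M.Point

/-- The edges incident on the vertex `v`. -/
def incident (v : V) : Set M.Edge := {e | v ∈ e.1}

/-- The boundary of the completion: the boundary vertices (those with exactly one incident edge),
and the points of the completion which are not in the graph. -/
def boundary : Set M.Compl :=
  {x | ∃ v, (M.incident v).ncard = 1 ∧ x = (Point.vertex v : M.Point)} ∪
    (range ((↑) : M.Point → M.Compl))ᶜ

/-- The completion is weakly connected: any two distinct points are separated by a finite set of
points of the graph. -/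
def WeaklyConnected : Prop :=
  ∀ x y : M.Compl, x ≠ y → ∃ W : Set M.Compl, W.Finite ∧ W ⊆ range ((↑) : M.Point → M.Compl) ∧
    ∃ A B : Set M.Compl, IsOpen A ∧ IsOpen B ∧ Disjoint A B ∧ Wᶜ = A ∪ B ∧ x ∈ A ∧ y ∈ B

noncomputable instance : MeasurableSpace M.Point := borel M.Point

instance : BorelSpace M.Point := ⟨rfl⟩

/-- The measure on the graph extending Lebesgue measure on the edges. -/
noncomputable def volume : Measure M.Point :=
  Measure.sum fun e : M.Edge =>
    (MeasureTheory.volume.restrict (Ioo 0 (M.len e))).map (M.edgePoint e)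

/-- The function on the graph equal to `ω e` on the open edge `e` (the value at the vertices,
a null set, is irrelevant). -/
def edgeConst (ω : M.Edge → ℝ) : M.Point → ℝ
  | .vertex _ => 0
  | .inner e _ _ => ω e

/-- The restriction of a function on the graph to the edge `e`, in the coordinate on
`[0, len e]`. -/
noncomputable def onEdge (u : M.Point → ℝ) (e : M.Edge) (t : ℝ) : ℝ := u (M.edgePoint e t)

/-- The derivative of `u` along the closed edge `e` (one-sided at the endpoints). -/
noncomputable def edgeDeriv (u : M.Point → ℝ) (e : M.Edge) : ℝ → ℝ :=
  derivWithin (M.onEdge u e) (Icc 0 (M.len e))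

open Classical in
/-- The derivative of `u` along the edge `e` at its endpoint `v`, in the direction pointing from
`v` into the edge. -/
noncomputable def outwardDeriv (u : M.Point → ℝ) (v : V) (e : M.Edge) : ℝ :=
  if v = M.source e then M.edgeDeriv u e 0 else -M.edgeDeriv u e (M.len e)

/-- `u` is `q`-harmonic: on each edge `u'` exists and is absolutely continuous and `u'' = q u`
almost everywhere, and at every vertex of degree at least two the outward derivatives sum to `0`.
(Continuity at the vertices is part of differentiability on the closed edges, since all edges
incident on `v` share the value of `u` at `v`.) -/
structure IsQHarmonic (q u : M.Point → ℝ) : Prop where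
  differentiableOn : ∀ e, DifferentiableOn ℝ (M.onEdge u e) (Icc 0 (M.len e))
  absolutelyContinuous : ∀ e, AbsolutelyContinuousOnInterval (M.edgeDeriv u e) 0 (M.len e)
  equation : ∀ e, ∀ᵐ t ∂(MeasureTheory.volume.restrict (Ioo 0 (M.len e))),
    HasDerivAt (M.edgeDeriv u e) (M.onEdge q e t * M.onEdge u e t) t
  vertexCondition : ∀ v, 2 ≤ (M.incident v).ncard →
    ∑ᶠ e ∈ M.incident v, M.outwardDeriv u v e = 0

/-- `u` is a continuous function on the completion which is `q`-harmonic on the graph and has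
boundary values `U`. -/
structure IsQHarmonicExtension (q : M.Point → ℝ) (U : M.boundary → ℝ) (u : M.Compl → ℝ) :
    Prop where
  continuous : Continuous u
  isQHarmonic : M.IsQHarmonic q (fun x : M.Point => u x)
  boundaryValue : ∀ b : M.boundary, u b = U b

/-- The algebra of eventually flat functions: continuous on the completion, smooth on the open
edges, with derivative vanishing outside finitely many edges and near every vertex (by local
finiteness, the latter means near both ends of every edge). -/
structure EventuallyFlat (φ : M.Compl → ℝ) : Prop where
  continuous : Continuous φ
  smooth : ∀ e, ContDiffOn ℝ (⊤ : ℕ∞) (M.onEdge (fun x => φ x) e) (Ioo 0 (M.len e))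
  flat : ∃ S : Set M.Edge, S.Finite ∧
    ∀ e ∉ S, ∀ t ∈ Ioo 0 (M.len e), deriv (M.onEdge (fun x => φ x) e) t = 0
  flat_source : ∀ e, ∀ᶠ t in 𝓝[>] 0, deriv (M.onEdge (fun x => φ x) e) t = 0
  flat_target : ∀ e, ∀ᶠ t in 𝓝[<] (M.len e), deriv (M.onEdge (fun x => φ x) e) t = 0

/-- The second derivative along the edges (set to `0` at the vertices, a null set near which
eventually flat functions are locally constant). -/
noncomputable def secondDeriv (f : M.Point → ℝ) : M.Point → ℝ
  | .vertex _ => 0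
  | .inner e t _ => deriv (deriv (M.onEdge f e)) t

/-- The differential expression `L f = -f'' + q f`. -/
noncomputable def L (q f : M.Point → ℝ) (x : M.Point) : ℝ := -M.secondDeriv f x + q x * f x

/-- `φ` is an eventually flat function with `φ = 1` on `Ω` and `φ = 0` on the rest of the
boundary. -/
structure IsTestFunction (Ω : Set M.boundary) (φ : M.Compl → ℝ) : Prop where
  eventuallyFlat : M.EventuallyFlat φ
  eq_one : ∀ b ∈ Ω, φ b = 1
  eq_zero : ∀ b ∉ Ω, φ b = 0

open Classical in
/-- The `q`-harmonic extension of `U` (and `0` if there is none). -/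
noncomputable def qHarmonicExtension (q : M.Point → ℝ) (U : M.boundary → ℝ) : M.Compl → ℝ :=
  if h : ∃ u, M.IsQHarmonicExtension q U u then h.choose else 0

open Classical in
/-- A test function for the set `Ω` (and `0` if there is none). -/
noncomputable def testFunction (Ω : Set M.boundary) : M.Compl → ℝ :=
  if h : ∃ φ, M.IsTestFunction Ω φ then h.choose else 0

/-- The Dirichlet-Neumann function `Λ_q(U, Ω) = ∫ u L φ`, where `u` is the `q`-harmonic extension
of `U` and `φ` is a test function for `Ω`. -/
noncomputable def dirichletNeumann (q : M.Point → ℝ) (U : M.boundary → ℝ)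
    (Ω : Set M.boundary) : ℝ :=
  ∫ x, M.qHarmonicExtension q U x * M.L q (fun y => M.testFunction Ω y) x ∂M.volume

end MetricGraph

/-! ### Solutions of `u'' = q u` on an interval -/

/-! The existence half is Dirichlet's principle followed by a density argument. On one edge, `u'' =
q u` has a unique solution with prescribed end values, so a harmonic function is determined by its
vertex values `f`. Its energy `∫ u'² + q u²` on the edge is, by Green's identity, a quadratic form
in the two end values, and the gradient of this form is given by the outward derivatives. Minimizing
the total energy therefore produces the vertex condition.

Finite energy forces Hölder continuity of exponent 1/2, by Cauchy–Schwarz along a path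
(`sq_sub_le_dist`), so such an `f` extends to the completion. If the boundary values come from a
flat vertex function, one that is constant along all but finitely many edges, then the energy can be
made finite because `q` is integrable (`energy_lt_top`). The Hölder bound makes the admissible class
compact, and a minimizer exists (`exists_minimizer`).

Weak connectedness makes the boundary values of flat functions an algebra that separates points, so
it is dense in `C(∂)` by Stone–Weierstrass. By the maximum principle (`le_of_le_boundary`),
restriction to the boundary is an isometry on the closed space of harmonic functions. Its range is
then closed and contains a dense set, hence is everything (`exists_isHarmonic`).

For the formula, let `φ` be a test function equal to 1 on the boundary and write `Lφ = q + (-φ'' +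
q(φ - 1))`. Integrating the bracket against `u` by parts leaves only terms `u'·(φ - 1)` at the ends
of edges. By compactness `φ = 1` at all but finitely many vertices (`finite_ne_one`). Regrouped by
vertex, these terms form a finite sum that vanishes by the vertex condition. Finally `u ≥ 0` by the
maximum principle, and `∫ u q = 0` would force `u = 0` on every edge, hence on the completion. -/

theorem intervalIntegral_congr_Ioo {l : ℝ} (hl : 0 ≤ l) {f g : ℝ → ℝ}
    (h : ∀ᵐ t ∂(volume.restrict (Ioo 0 l)), f t = g t) :
    ∫ t in (0 : ℝ)..l, f t = ∫ t in (0 : ℝ)..l, g t := by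
  rw [intervalIntegral.integral_of_le hl, intervalIntegral.integral_of_le hl,
    integral_Ioc_eq_integral_Ioo, integral_Ioc_eq_integral_Ioo]
  exact integral_congr_ae h

theorem AbsolutelyContinuousOnInterval.congr_of_eqOn {f g : ℝ → ℝ} {a b : ℝ}
    (hf : AbsolutelyContinuousOnInterval f a b) (h : EqOn f g (uIcc a b)) :
    AbsolutelyContinuousOnInterval g a b := by
  rw [absolutelyContinuousOnInterval_iff] at hf ⊢
  intro ε hε
  obtain ⟨δ, hδ, H⟩ := hf ε hε
  refine ⟨δ, hδ, fun E hE hEδ => ?_⟩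
  have := H E hE hEδ
  refine lt_of_eq_of_lt (Finset.sum_congr rfl fun i hi => ?_) this
  rw [h (hE.1 i hi).1, h (hE.1 i hi).2]

/-- `u` is a solution of `u'' = q u` on `[0, l]`, with derivative `p`. -/
structure IsSol (l : ℝ) (q u p : ℝ → ℝ) : Prop where
  hasDeriv : ∀ t ∈ Icc 0 l, HasDerivWithinAt u (p t) (Icc 0 l) t
  ac : AbsolutelyContinuousOnInterval p 0 l
  eqn : ∀ᵐ t ∂(volume.restrict (Ioo 0 l)), HasDerivAt p (q t * u t) t

theorem absolutelyContinuousOnInterval_of_hasDerivWithinAt {l : ℝ} (hl : 0 ≤ l) {g g' : ℝ → ℝ}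
    (hg : ∀ t ∈ Icc 0 l, HasDerivWithinAt g (g' t) (Icc 0 l) t) (hg' : ContinuousOn g' (Icc 0 l)) :
    AbsolutelyContinuousOnInterval g 0 l := by
  obtain ⟨C, hC⟩ := isCompact_Icc.exists_bound_of_continuousOn hg'
  have : LipschitzOnWith C.toNNReal g (Icc 0 l) := by
    refine (convex_Icc 0 l).lipschitzOnWith_of_nnnorm_hasDerivWithin_le hg fun t ht => ?_
    rw [← NNReal.coe_le_coe, coe_nnnorm]
    exact (hC t ht).trans (Real.le_coe_toNNReal C)
  rw [← uIcc_of_le hl] at this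
  exact this.absolutelyContinuousOnInterval

/-- Since `q` is merely integrable, one factor is only absolutely continuous, with its derivative
known almost everywhere. Green's identity and the integration against test functions are both
instances. -/
theorem integral_by_parts_of_ac {l : ℝ} (hl : 0 ≤ l) {p r g g' : ℝ → ℝ}
    (hp : AbsolutelyContinuousOnInterval p 0 l)
    (hr : ∀ᵐ t ∂(volume.restrict (Ioo 0 l)), HasDerivAt p (r t) t)
    (hg : ∀ t ∈ Icc 0 l, HasDerivWithinAt g (g' t) (Icc 0 l) t) (hg' : ContinuousOn g' (Icc 0 l)) :
    ∫ t in (0 : ℝ)..l, (r t * g t + p t * g' t) = p l * g l - p 0 * g 0 := by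
  rw [← hp.integral_deriv_mul_eq_sub (absolutelyContinuousOnInterval_of_hasDerivWithinAt hl hg hg')]
  refine intervalIntegral_congr_Ioo hl ?_
  filter_upwards [hr, ae_restrict_mem measurableSet_Ioo] with t h1 h2
  rw [h1.deriv, ((hg t (Ioo_subset_Icc_self h2)).hasDerivAt (Icc_mem_nhds h2.1 h2.2)).deriv]

namespace IsSol

variable {l : ℝ} {q u p v r : ℝ → ℝ}

theorem continuousOn_deriv (h : IsSol l q u p) (hl : 0 ≤ l) : ContinuousOn p (Icc 0 l) := by
  simpa [uIcc_of_le hl] using h.ac.continuousOn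

theorem continuousOn (h : IsSol l q u p) : ContinuousOn u (Icc 0 l) := fun t ht =>
  (h.hasDeriv t ht).continuousWithinAt

theorem comb (hu : IsSol l q u p) (hv : IsSol l q v r) (α β : ℝ) :
    IsSol l q (fun t => α * u t + β * v t) (fun t => α * p t + β * r t) where
  hasDeriv t ht := ((hu.hasDeriv t ht).const_mul α).add ((hv.hasDeriv t ht).const_mul β)
  ac := (hu.ac.const_mul α).fun_add (hv.ac.const_mul β)
  eqn := by
    filter_upwards [hu.eqn, hv.eqn] with t h1 h2
    exact ((h1.const_mul α).add (h2.const_mul β)).congr_deriv (by ring)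

/-- Only the values of `q` on the open interval matter, so `q` may be replaced by its indicator
there, which is integrable on the whole line. -/
theorem congr_q {q' : ℝ → ℝ} (hu : IsSol l q u p) (h : ∀ t ∈ Ioo 0 l, q t = q' t) :
    IsSol l q' u p where
  hasDeriv := hu.hasDeriv
  ac := hu.ac
  eqn := by
    filter_upwards [hu.eqn, ae_restrict_mem measurableSet_Ioo] with t h1 h2
    rwa [← h t h2]

/-- Green's identity. -/
theorem green (hl : 0 ≤ l) (hu : IsSol l q u p) (hv : IsSol l q v r) :
    ∫ t in (0 : ℝ)..l, (q t * u t * v t + p t * r t) = p l * v l - p 0 * v 0 :=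
  integral_by_parts_of_ac hl hu.ac hu.eqn hv.hasDeriv (hv.continuousOn_deriv hl)

theorem deriv_sub (hu : IsSol l q u p) {s t : ℝ} (hs : 0 ≤ s) (hst : s ≤ t)
    (ht : t ≤ l) : p t - p s = ∫ x in s..t, q x * u x := by
  have hsub : uIcc s t ⊆ uIcc 0 l := by
    rw [uIcc_of_le hst, uIcc_of_le (hs.trans (hst.trans ht))]
    exact Icc_subset_Icc hs ht
  rw [← (hu.ac.mono hsub).integral_deriv_eq_sub]
  rw [intervalIntegral.integral_of_le hst, intervalIntegral.integral_of_le hst,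
    integral_Ioc_eq_integral_Ioo, integral_Ioc_eq_integral_Ioo]
  refine integral_congr_ae ?_
  have := ae_restrict_of_ae_restrict_of_subset (Ioo_subset_Ioo hs ht) hu.eqn
  filter_upwards [this] with x hx
  exact hx.deriv

theorem sub_eq_integral (hl : 0 ≤ l) (hu : IsSol l q u p) {s t : ℝ} (hs : 0 ≤ s) (hst : s ≤ t)
    (ht : t ≤ l) : u t - u s = ∫ x in s..t, p x := by
  have hsub : Icc s t ⊆ Icc 0 l := Icc_subset_Icc hs ht
  symm
  refine intervalIntegral.integral_eq_sub_of_hasDeriv_right_of_le hst (hu.continuousOn.mono hsub)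
    (fun x hx => ?_) ?_
  · have hx' : x ∈ Icc 0 l := hsub (Ioo_subset_Icc_self hx)
    exact ((hu.hasDeriv x hx').hasDerivAt
      (Icc_mem_nhds (hs.trans_lt hx.1) (hx.2.trans_le ht))).hasDerivWithinAt
  · refine ContinuousOn.intervalIntegrable ?_
    rw [uIcc_of_le hst]
    exact (hu.continuousOn_deriv hl).mono hsub

end IsSol

/-! ### Existence for the initial value problem with integrable `q` -/

/-- The primitive `Q` of `q` is absolutely continuous, so `(Q^(n+1))' = (n+1) q Q^n` almost
everywhere. This creates the factorials in the Picard estimate below. -/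
theorem integral_mul_primitive_pow {q : ℝ → ℝ} (hq : Integrable q) (n : ℕ) (s : ℝ) :
    ∫ r in (0 : ℝ)..s, q r * (∫ x in (0 : ℝ)..r, q x) ^ n
      = (∫ x in (0 : ℝ)..s, q x) ^ (n + 1) / (n + 1) := by
  have hi : IntervalIntegrable q volume 0 s := hq.intervalIntegrable
  have h1 := hi.absolutelyContinuousOnInterval_intervalIntegral (c := 0) (by simp)
  have h2 : ∀ m : ℕ, AbsolutelyContinuousOnInterval
      (fun r => (∫ x in (0 : ℝ)..r, q x) ^ (m + 1)) 0 s := by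
    intro m
    induction m with
    | zero => simpa using h1
    | succ m ih => simpa only [pow_succ _ (m + 1)] using ih.fun_mul h1
  have h3 := (h2 n).integral_deriv_eq_sub
  rw [eq_div_iff (by positivity)]
  have h4 : ∫ r in (0 : ℝ)..s, deriv (fun r => (∫ x in (0 : ℝ)..r, q x) ^ (n + 1)) r
      = ∫ r in (0 : ℝ)..s, (q r * (∫ x in (0 : ℝ)..r, q x) ^ n) * (n + 1) := by
    refine intervalIntegral.integral_congr_ae ?_
    filter_upwards [hi.ae_hasDerivAt_integral] with r hr hr'
    rw [((hr (uIoc_subset_uIcc hr') 0 (by simp)).fun_pow (n + 1)).deriv]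
    push_cast
    ring
  rw [h4, intervalIntegral.integral_mul_const] at h3
  simpa using h3

/-- Picard iteration for the integrated form of `u'' = q u`, `u(0) = α`, `u'(0) = γ`. The integral
operator need not be a contraction, but the Lipschitz constant of its `n`-th iterate is at most `(l
Q(l))^n / n!`, so neither `l` nor `q` has to be small. -/
theorem exists_volterra {l : ℝ} (hl : 0 < l) {q : ℝ → ℝ} (hq : Integrable q) (hq0 : ∀ t, 0 ≤ q t)
    (α γ : ℝ) : ∃ u : ℝ → ℝ, Continuous u ∧
      ∀ t ∈ Icc 0 l, u t = α + ∫ s in (0 : ℝ)..t, (γ + ∫ r in (0 : ℝ)..s, q r * u r) := by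
  -- `projIcc` extends a function on `[0, l]` to the line by constants, so all integrands are
  -- globally integrable.
  have hint : ∀ w : C(Icc 0 l, ℝ), Integrable fun r => q r * w (projIcc 0 l hl.le r) := by
    intro w
    refine hq.mul_bdd (c := ‖w‖) ?_ (Eventually.of_forall fun r => w.norm_coe_le_norm _)
    exact (w.continuous.comp continuous_projIcc).aestronglyMeasurable
  have hc1 : ∀ w : C(Icc 0 l, ℝ),
      Continuous fun s => γ + ∫ r in (0 : ℝ)..s, q r * w (projIcc 0 l hl.le r) := fun w =>
    continuous_const.add (intervalIntegral.continuous_primitive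
      (fun a b => (hint w).intervalIntegrable) 0)
  have hc2 : ∀ w : C(Icc 0 l, ℝ), Continuous fun t => α + ∫ s in (0 : ℝ)..t,
      (γ + ∫ r in (0 : ℝ)..s, q r * w (projIcc 0 l hl.le r)) := fun w =>
    continuous_const.add (intervalIntegral.continuous_primitive
      (fun a b => (hc1 w).intervalIntegrable _ _) 0)
  let T : C(Icc 0 l, ℝ) → C(Icc 0 l, ℝ) := fun w =>
    ⟨fun t => α + ∫ s in (0 : ℝ)..t, (γ + ∫ r in (0 : ℝ)..s, q r * w (projIcc 0 l hl.le r)),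
      (hc2 w).comp continuous_subtype_val⟩
  let Q : ℝ → ℝ := fun t => ∫ x in (0 : ℝ)..t, q x
  have hQmono : Monotone Q := by
    intro a b hab
    have : Q b - Q a = ∫ x in a..b, q x :=
      intervalIntegral.integral_interval_sub_left hq.intervalIntegrable hq.intervalIntegrable
    have h0 : 0 ≤ ∫ x in a..b, q x := intervalIntegral.integral_nonneg hab fun x _ => hq0 x
    linarith
  have hQ0 : ∀ t, 0 ≤ t → 0 ≤ Q t := fun t ht => by simpa [Q] using hQmono ht
  -- In the induction the inner integral turns `Q^n / n!` into `Q^(n+1) / (n+1)!`, and the outer one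
  -- contributes a factor at most `l`.
  have hbound : ∀ (n : ℕ) (v w : C(Icc 0 l, ℝ)) (t : Icc 0 l),
      |T^[n] v t - T^[n] w t| ≤ dist v w * ((l * Q t) ^ n / n.factorial) := by
    intro n
    induction n with
    | zero => intro v w t; simpa [Real.dist_eq] using ContinuousMap.dist_apply_le_dist (f := v) t
    | succ n ih =>
      intro v w t
      rw [Function.iterate_succ_apply', Function.iterate_succ_apply']
      set v' := T^[n] v
      set w' := T^[n] w
      have hd : (T v') t - (T w') t = ∫ s in (0 : ℝ)..t, ∫ r in (0 : ℝ)..s,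
          q r * (v' (projIcc 0 l hl.le r) - w' (projIcc 0 l hl.le r)) := by
        change (α + _) - (α + _) = _
        rw [add_sub_add_left_eq_sub, ← intervalIntegral.integral_sub
          ((hc1 v').intervalIntegrable _ _) ((hc1 w').intervalIntegrable _ _)]
        refine intervalIntegral.integral_congr fun s _ => ?_
        rw [add_sub_add_left_eq_sub, ← intervalIntegral.integral_sub
          (hint v').intervalIntegrable (hint w').intervalIntegrable]
        simp only [mul_sub]
      have hin : ∀ s ∈ uIoc (0 : ℝ) t, ‖∫ r in (0 : ℝ)..s,
          q r * (v' (projIcc 0 l hl.le r) - w' (projIcc 0 l hl.le r))‖ ≤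
          dist v w * (l ^ n * Q t ^ (n + 1) / (n + 1).factorial) := by
        intro s hs
        rw [uIoc_of_le t.2.1] at hs
        have hcQ : Continuous Q := intervalIntegral.continuous_primitive
          (fun a b => hq.intervalIntegrable) 0
        have h1 : ‖∫ r in (0 : ℝ)..s,
            q r * (v' (projIcc 0 l hl.le r) - w' (projIcc 0 l hl.le r))‖ ≤
            ∫ r in (0 : ℝ)..s, (dist v w * (l ^ n / n.factorial)) * (q r * Q r ^ n) := by
          refine intervalIntegral.norm_integral_le_of_norm_le hs.1.le ?_ ?_
          · refine Eventually.of_forall fun r hr => ?_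
            have hr' : r ∈ Icc 0 l := ⟨hr.1.le, hr.2.trans (hs.2.trans t.2.2)⟩
            have := ih v w ⟨r, hr'⟩
            rw [projIcc_of_mem hl.le hr', norm_mul, Real.norm_of_nonneg (hq0 r), Real.norm_eq_abs]
            calc q r * _ ≤ q r * _ := mul_le_mul_of_nonneg_left this (hq0 r)
              _ = _ := by simp only [mul_pow]; ring
          · exact ((hq.intervalIntegrable).mul_continuousOn
              (hcQ.pow n).continuousOn).const_mul _
        refine h1.trans ?_
        rw [intervalIntegral.integral_const_mul, integral_mul_primitive_pow hq]
        have h2 : Q s ^ (n + 1) ≤ Q t ^ (n + 1) :=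
          pow_le_pow_left₀ (hQ0 s hs.1.le) (hQmono hs.2) _
        rw [Nat.factorial_succ]
        push_cast
        calc dist v w * (l ^ n / n.factorial) * (Q s ^ (n + 1) / (n + 1))
            ≤ dist v w * (l ^ n / n.factorial) * (Q t ^ (n + 1) / (n + 1)) := by gcongr
          _ = _ := by field_simp
      have hQt : 0 ≤ Q t := hQ0 t t.2.1
      rw [hd]
      refine (intervalIntegral.norm_integral_le_of_norm_le_const hin).trans ?_
      rw [sub_zero, abs_of_nonneg t.2.1]
      calc dist v w * (l ^ n * Q t ^ (n + 1) / (n + 1).factorial) * t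
          ≤ dist v w * (l ^ n * Q t ^ (n + 1) / (n + 1).factorial) * l := by
            gcongr; exact t.2.2
        _ = _ := by rw [mul_pow]; ring
  obtain ⟨n, hn⟩ : ∃ n : ℕ, (l * Q l) ^ n / n.factorial < 1 / 2 :=
    ((FloorSemiring.tendsto_pow_div_factorial_atTop (l * Q l)).eventually
      (gt_mem_nhds (by norm_num))).exists
  have hcontr : ContractingWith (1 / 2) T^[n] := by
    refine ⟨by rw [← NNReal.coe_lt_coe]; norm_num, LipschitzWith.of_dist_le_mul fun v w => ?_⟩
    rw [ContinuousMap.dist_le (by positivity)]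
    intro t
    rw [Real.dist_eq]
    refine (hbound n v w t).trans ?_
    rw [mul_comm]
    refine mul_le_mul_of_nonneg_right (le_trans ?_ (hn.le.trans (by simp))) dist_nonneg
    have hQt : 0 ≤ Q t := hQ0 t t.2.1
    have : Q t ≤ Q l := hQmono t.2.2
    gcongr
  -- The fixed point of `T^[n]` is fixed by `T` too, because `T` commutes with its iterate and that
  -- fixed point is unique.
  have hfix := hcontr.isFixedPt_fixedPoint_iterate
  set w := hcontr.fixedPoint T^[n]
  refine ⟨fun t => w (projIcc 0 l hl.le t), w.continuous.comp continuous_projIcc, fun t ht => ?_⟩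
  have := congrArg (fun f : C(Icc 0 l, ℝ) => f ⟨t, ht⟩) hfix.eq
  simp only at this ⊢
  rw [projIcc_of_mem hl.le ht, ← this]
  rfl

theorem exists_isSol {l : ℝ} (hl : 0 < l) {q : ℝ → ℝ} (hq : IntegrableOn q (Ioo 0 l))
    (hq0 : ∀ t, 0 ≤ q t) (α γ : ℝ) : ∃ u p, IsSol l q u p ∧ u 0 = α ∧ p 0 = γ := by
  have hq' : Integrable ((Ioo 0 l).indicator q) := hq.integrable_indicator measurableSet_Ioo
  obtain ⟨u, huc, hu⟩ := exists_volterra hl hq'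
    (fun t => indicator_nonneg (fun t _ => hq0 t) t) α γ
  have hint : IntervalIntegrable (fun r => (Ioo 0 l).indicator q r * u r) volume 0 l :=
    hq'.intervalIntegrable.mul_continuousOn huc.continuousOn
  have hint' : ∀ a b, IntervalIntegrable (fun r => (Ioo 0 l).indicator q r * u r) volume a b :=
    fun a b => hq'.intervalIntegrable.mul_continuousOn huc.continuousOn
  let p : ℝ → ℝ := fun s => γ + ∫ r in (0 : ℝ)..s, (Ioo 0 l).indicator q r * u r
  have hp : Continuous p := continuous_const.add (intervalIntegral.continuous_primitive hint' 0)
  refine ⟨u, p, IsSol.congr_q (q := (Ioo 0 l).indicator q) ⟨fun t ht => ?_, ?_, ?_⟩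
    (fun t ht => indicator_of_mem ht q), ?_, ?_⟩
  · have : HasDerivAt (fun t => α + ∫ s in (0 : ℝ)..t, p s) (p t) t :=
      (hp.integral_hasStrictDerivAt 0 t).hasDerivAt.const_add α
    exact this.hasDerivWithinAt.congr hu (hu t ht)
  · have h0 : AbsolutelyContinuousOnInterval (fun _ : ℝ => γ) 0 l :=
      (LipschitzWith.const γ).lipschitzOnWith.absolutelyContinuousOnInterval
    exact h0.fun_add (hint.absolutelyContinuousOnInterval_intervalIntegral (c := 0) (by simp))
  · rw [ae_restrict_iff' measurableSet_Ioo]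
    filter_upwards [hint.ae_hasDerivAt_integral] with t ht htl
    rw [uIcc_of_le hl.le] at ht
    exact (ht (Ioo_subset_Icc_self htl) 0 ⟨le_rfl, hl.le⟩).const_add γ
  · simpa using hu 0 ⟨le_rfl, hl.le⟩
  · simp [p]

/-! ### One-sided maximum principle and energy estimates on an edge -/

namespace IsSol

variable {l : ℝ} {q u p v r : ℝ → ℝ}

theorem intervalIntegrable_mul (hl : 0 ≤ l) (hq : IntegrableOn q (Ioo 0 l))
    {f : ℝ → ℝ} (hf : ContinuousOn f (Icc 0 l)) {s t : ℝ} (hs : 0 ≤ s) (hst : s ≤ t) (ht : t ≤ l) :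
    IntervalIntegrable (fun x => q x * f x) volume s t := by
  have h1 : IntervalIntegrable q volume 0 l := by
    rw [intervalIntegrable_iff_integrableOn_Ioo_of_le hl]
    exact hq
  have h2 := h1.mul_continuousOn (g := f) (by rwa [uIcc_of_le hl])
  refine h2.mono_set ?_
  rw [uIcc_of_le hst, uIcc_of_le hl]
  exact Icc_subset_Icc hs ht

/-- A solution cannot have a positive maximum with nonnegative derivative to the right. -/
theorem deriv_neg_of_max_right (hu : IsSol l q u p) (hl : 0 ≤ l) (hq : IntegrableOn q (Ioo 0 l))
    (hq0 : ∀ t, 0 < q t) {m t₀ : ℝ} (hm : 0 < m) (h0 : 0 ≤ t₀) (h0l : t₀ < l) (hu0 : u t₀ = m)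
    (hmax : ∀ t ∈ Icc 0 l, u t ≤ m) : p t₀ < 0 := by
  by_contra! hp
  have hpos : ∀ᶠ t in 𝓝[Icc 0 l] t₀, 0 < u t :=
    (hu.continuousOn t₀ ⟨h0, h0l.le⟩).eventually (lt_mem_nhds (hu0 ▸ hm))
  obtain ⟨δ, hδ, hball⟩ := Metric.mem_nhdsWithin_iff.1 hpos
  obtain ⟨b, hb0, hb⟩ : ∃ b, t₀ < b ∧ b < min l (t₀ + δ) :=
    exists_between (lt_min h0l (by linarith))
  have hbl : b < l := hb.trans_le (min_le_left _ _)
  have hbδ : b < t₀ + δ := hb.trans_le (min_le_right _ _)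
  have hup : ∀ t, t₀ ≤ t → t ≤ b → 0 < u t := fun t h1 h2 => hball
    ⟨by rw [Metric.mem_ball, Real.dist_eq, abs_lt]; constructor <;> linarith,
      h0.trans h1, h2.trans hbl.le⟩
  -- While `u > 0` the derivative `p` strictly increases, here from a nonnegative value, so `u`
  -- would rise above its maximum.
  have hpp : ∀ t, t₀ < t → t ≤ b → 0 < p t := by
    intro t h1 h2
    have h3 := hu.deriv_sub h0 h1.le (h2.trans hbl.le)
    have h4 : 0 < ∫ x in t₀..t, q x * u x :=
      intervalIntegral.intervalIntegral_pos_of_pos_on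
        (intervalIntegrable_mul hl hq hu.continuousOn h0 h1.le (h2.trans hbl.le))
        (fun x hx => mul_pos (hq0 x) (hup x hx.1.le (hx.2.le.trans h2))) h1
    linarith
  have h5 := hu.sub_eq_integral hl h0 hb0.le hbl.le
  have h6 : 0 < ∫ x in t₀..b, p x := by
    refine intervalIntegral.intervalIntegral_pos_of_pos_on ?_
      (fun x hx => hpp x hx.1 hx.2.le) hb0
    refine ContinuousOn.intervalIntegrable ?_
    rw [uIcc_of_le hb0.le]
    exact (hu.continuousOn_deriv hl).mono (Icc_subset_Icc h0 hbl.le)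
  have := hmax b ⟨h0.trans hb0.le, hbl.le⟩
  linarith

/-- A solution cannot have a positive maximum with nonpositive derivative to the left. -/
theorem deriv_pos_of_max_left (hu : IsSol l q u p) (hl : 0 ≤ l) (hq : IntegrableOn q (Ioo 0 l))
    (hq0 : ∀ t, 0 < q t) {m t₀ : ℝ} (hm : 0 < m) (h0 : 0 < t₀) (h0l : t₀ ≤ l) (hu0 : u t₀ = m)
    (hmax : ∀ t ∈ Icc 0 l, u t ≤ m) : 0 < p t₀ := by
  by_contra! hp
  have hpos : ∀ᶠ t in 𝓝[Icc 0 l] t₀, 0 < u t :=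
    (hu.continuousOn t₀ ⟨h0.le, h0l⟩).eventually (lt_mem_nhds (hu0 ▸ hm))
  obtain ⟨δ, hδ, hball⟩ := Metric.mem_nhdsWithin_iff.1 hpos
  obtain ⟨b, hb, hb0⟩ : ∃ b, max 0 (t₀ - δ) < b ∧ b < t₀ :=
    exists_between (max_lt h0 (by linarith))
  have hbl : 0 < b := (le_max_left _ _).trans_lt hb
  have hbδ : t₀ - δ < b := (le_max_right _ _).trans_lt hb
  have hup : ∀ t, t ≤ t₀ → b ≤ t → 0 < u t := fun t h1 h2 => hball
    ⟨by rw [Metric.mem_ball, Real.dist_eq, abs_lt]; constructor <;> linarith,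
      hbl.le.trans h2, h1.trans h0l⟩
  have hpp : ∀ t, t < t₀ → b ≤ t → p t < 0 := by
    intro t h1 h2
    have h3 := hu.deriv_sub (hbl.le.trans h2) h1.le h0l
    have h4 : 0 < ∫ x in t..t₀, q x * u x :=
      intervalIntegral.intervalIntegral_pos_of_pos_on
        (intervalIntegrable_mul hl hq hu.continuousOn (hbl.le.trans h2) h1.le h0l)
        (fun x hx => mul_pos (hq0 x) (hup x hx.2.le (h2.trans hx.1.le))) h1
    linarith
  have h5 := hu.sub_eq_integral hl hbl.le hb0.le h0l
  have h6 : 0 < ∫ x in b..t₀, -p x := by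
    refine intervalIntegral.intervalIntegral_pos_of_pos_on ?_
      (fun x hx => neg_pos.2 (hpp x hx.2 hx.1.le)) hb0
    refine ContinuousOn.intervalIntegrable ?_
    rw [uIcc_of_le hb0.le]
    exact ((hu.continuousOn_deriv hl).mono (Icc_subset_Icc hbl.le h0l)).neg
  rw [intervalIntegral.integral_neg] at h6
  have := hmax b ⟨hbl.le, hb0.le.trans h0l⟩
  linarith

/-- Cauchy–Schwarz for `u t - u s = ∫ p`, together with `∫ p² ≤ ∫ (q u² + p²)`; the latter equals
the boundary term by Green's identity. -/
theorem sq_sub_le (hu : IsSol l q u p) (hl : 0 ≤ l) (hq : IntegrableOn q (Ioo 0 l))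
    (hq0 : ∀ t, 0 ≤ q t) {s t : ℝ} (hs : 0 ≤ s) (hst : s ≤ t) (ht : t ≤ l) :
    (u t - u s) ^ 2 ≤ (t - s) * (p l * u l - p 0 * u 0) := by
  rcases hst.eq_or_lt with rfl | hst'
  · simp
  have hpc := hu.continuousOn_deriv hl
  have hsub : Icc s t ⊆ Icc 0 l := Icc_subset_Icc hs ht
  have hpi : IntervalIntegrable p volume s t :=
    ContinuousOn.intervalIntegrable (by rw [uIcc_of_le hst]; exact hpc.mono hsub)
  have hpi2 : IntervalIntegrable (fun x => p x * p x) volume s t :=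
    ContinuousOn.intervalIntegrable
      (by rw [uIcc_of_le hst]; exact (hpc.mono hsub).mul (hpc.mono hsub))
  set D := t - s with hD
  have hD0 : 0 < D := sub_pos.2 hst'
  set I := ∫ x in s..t, p x with hI
  -- Cauchy–Schwarz in the form that the variance of `p` about its mean `I / D` is nonnegative.
  have h1 : 0 ≤ ∫ x in s..t, (p x - I / D) ^ 2 :=
    intervalIntegral.integral_nonneg hst fun x _ => sq_nonneg _
  have h2 : ∫ x in s..t, (p x - I / D) ^ 2 = (∫ x in s..t, p x * p x) - I ^ 2 / D := by
    have : ∀ x, (p x - I / D) ^ 2 = (p x * p x - 2 * (I / D) * p x) + (I / D) ^ 2 := fun x => by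
      ring
    simp_rw [this]
    rw [intervalIntegral.integral_add (hpi2.sub (hpi.const_mul _)) intervalIntegrable_const,
      intervalIntegral.integral_sub hpi2 (hpi.const_mul _), intervalIntegral.integral_const_mul,
      intervalIntegral.integral_const, ← hI, ← hD, smul_eq_mul]
    field_simp
    ring
  have hqi : IntervalIntegrable (fun x => q x * u x * u x) volume 0 l := by
    simpa only [mul_assoc] using intervalIntegrable_mul hl hq
      (f := fun x => u x * u x) (hu.continuousOn.mul hu.continuousOn) le_rfl hl le_rfl
  have hpi3 : IntervalIntegrable (fun x => p x * p x) volume 0 l :=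
    ContinuousOn.intervalIntegrable (by rw [uIcc_of_le hl]; exact hpc.mul hpc)
  have h3 : ∫ x in s..t, p x * p x ≤ ∫ x in (0 : ℝ)..l, (q x * u x * u x + p x * p x) := by
    rw [intervalIntegral.integral_add hqi hpi3]
    have h4 : 0 ≤ ∫ x in (0 : ℝ)..l, q x * u x * u x :=
      intervalIntegral.integral_nonneg hl fun x _ => by
        rw [mul_assoc]; exact mul_nonneg (hq0 x) (mul_self_nonneg _)
    have h5 : ∫ x in s..t, p x * p x ≤ ∫ x in (0 : ℝ)..l, p x * p x :=
      intervalIntegral.integral_mono_interval hs hst ht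
        (Eventually.of_forall fun x => mul_self_nonneg _) hpi3
    linarith
  rw [hu.green hl hu] at h3
  rw [hu.sub_eq_integral hl hs hst ht]
  have h6 : I ^ 2 / D ≤ p l * u l - p 0 * u 0 := by linarith
  rw [div_le_iff₀ hD0] at h6
  linarith

/-- Dirichlet's principle: the competitor is the constant 1, whose energy is `∫ q`. Expand `∫ q (u -
1)² + p² ≥ 0`; with end values 1, both `∫ (q u² + p²)` and `∫ q u` equal `p l - p 0`. -/
theorem energy_le_integral (hu : IsSol l q u p) (hl : 0 ≤ l) (hq : IntegrableOn q (Ioo 0 l))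
    (hq0 : ∀ t, 0 ≤ q t) (h0 : u 0 = 1) (h1 : u l = 1) :
    p l * u l - p 0 * u 0 ≤ ∫ x in (0 : ℝ)..l, q x := by
  have hpc := hu.continuousOn_deriv hl
  have hpi : IntervalIntegrable (fun x => p x * p x) volume 0 l :=
    ContinuousOn.intervalIntegrable (by rw [uIcc_of_le hl]; exact hpc.mul hpc)
  have hqi : IntervalIntegrable q volume 0 l := by
    rw [intervalIntegrable_iff_integrableOn_Ioo_of_le hl]
    exact hq
  have hqu : IntervalIntegrable (fun x => q x * u x) volume 0 l :=
    intervalIntegrable_mul hl hq hu.continuousOn le_rfl hl le_rfl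
  have hquu : IntervalIntegrable (fun x => q x * u x * u x) volume 0 l := by
    simpa only [mul_assoc] using intervalIntegrable_mul hl hq
      (f := fun x => u x * u x) (hu.continuousOn.mul hu.continuousOn) le_rfl hl le_rfl
  have h2 : 0 ≤ ∫ x in (0 : ℝ)..l, (q x * (u x - 1) ^ 2 + p x * p x) :=
    intervalIntegral.integral_nonneg hl fun x _ =>
      add_nonneg (mul_nonneg (hq0 x) (sq_nonneg _)) (mul_self_nonneg _)
  have h3 : ∀ x, q x * (u x - 1) ^ 2 + p x * p x
      = (q x * u x * u x + p x * p x) - 2 * (q x * u x) + q x := fun x => by ring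
  simp_rw [h3] at h2
  rw [intervalIntegral.integral_add ((hquu.add hpi).sub (hqu.const_mul _)) hqi,
    intervalIntegral.integral_sub (hquu.add hpi) (hqu.const_mul _), hu.green hl hu,
    intervalIntegral.integral_const_mul, ← hu.deriv_sub le_rfl hl le_rfl, h0, h1] at h2
  rw [h0, h1]
  linarith

end IsSol

/-- The data of the Dirichlet problem for `u'' = q u` on `[0, l]`: the fundamental solutions
`h₁`, `h₂` with boundary values `(1, 0)` and `(0, 1)`. -/
structure IsFundamental (l : ℝ) (q h₁ p₁ h₂ p₂ : ℝ → ℝ) : Prop where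
  sol₁ : IsSol l q h₁ p₁
  sol₂ : IsSol l q h₂ p₂
  h₁_zero : h₁ 0 = 1
  h₁_len : h₁ l = 0
  h₂_zero : h₂ 0 = 0
  h₂_len : h₂ l = 1

/-- Combine the solutions `c`, `s` with initial data `(1, 0)` and `(0, 1)`. This needs `s l ≠ 0`:
otherwise the energy of `s` vanishes, so `s` is identically 0 on the interval, against `s'(0) = 1`.
-/
theorem exists_isFundamental {l : ℝ} (hl : 0 < l) {q : ℝ → ℝ} (hq : IntegrableOn q (Ioo 0 l))
    (hq0 : ∀ t, 0 ≤ q t) : ∃ h₁ p₁ h₂ p₂, IsFundamental l q h₁ p₁ h₂ p₂ := by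
  obtain ⟨c, pc, hc, hc0, hpc0⟩ := exists_isSol hl hq hq0 1 0
  obtain ⟨s, ps, hs, hs0, hps0⟩ := exists_isSol hl hq hq0 0 1
  have hsl : s l ≠ 0 := by
    intro h
    have h2 : ∀ t ∈ Icc 0 l, s t = 0 := by
      intro t ht
      have := hs.sq_sub_le hl.le hq hq0 le_rfl ht.1 ht.2
      rw [h, hs0] at this
      simpa [hs0] using this
    have h3 := hs.hasDeriv 0 ⟨le_rfl, hl.le⟩
    have h4 : HasDerivWithinAt s 0 (Icc 0 l) 0 :=
      (hasDerivWithinAt_const (0 : ℝ) (Icc 0 l) (0 : ℝ)).congr h2 hs0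
    have := (uniqueDiffOn_Icc hl 0 ⟨le_rfl, hl.le⟩).eq_deriv _ h3 h4
    rw [hps0] at this
    exact one_ne_zero this
  refine ⟨_, _, _, _, hc.comb hs 1 (-(c l / s l)), hc.comb hs 0 (1 / s l), ?_, ?_, ?_, ?_⟩ <;>
    simp [hc0, hs0] <;> field_simp
  ring

namespace IsFundamental

variable {l : ℝ} {q h₁ p₁ h₂ p₂ : ℝ → ℝ}

/-- Green's identity is symmetric in the two solutions, so the matrix from end values to outward
derivatives is symmetric. -/
theorem symm (h : IsFundamental l q h₁ p₁ h₂ p₂) (hl : 0 ≤ l) : p₂ 0 = -p₁ l := by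
  have e1 := h.sol₁.green hl h.sol₂
  have e2 := h.sol₂.green hl h.sol₁
  have : ∀ t, q t * h₁ t * h₂ t + p₁ t * p₂ t = q t * h₂ t * h₁ t + p₂ t * p₁ t := fun t => by ring
  simp_rw [this, e2] at e1
  rw [h.h₁_zero, h.h₁_len, h.h₂_zero, h.h₂_len] at e1
  linarith

/-- The quadratic form on the right is the boundary term of Green's identity, with its two mixed
terms merged by `symm`. -/
theorem sq_sub_le (h : IsFundamental l q h₁ p₁ h₂ p₂) (hl : 0 ≤ l) (hq : IntegrableOn q (Ioo 0 l))
    (hq0 : ∀ t, 0 ≤ q t) (α β : ℝ) {s t : ℝ} (hs : s ∈ Icc 0 l) (ht : t ∈ Icc 0 l) :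
    ((α * h₁ s + β * h₂ s) - (α * h₁ t + β * h₂ t)) ^ 2
      ≤ |s - t| * (-p₁ 0 * α ^ 2 + 2 * p₁ l * α * β + p₂ l * β ^ 2) := by
  have hu := h.sol₁.comb h.sol₂ α β
  have key : ∀ s ∈ Icc 0 l, ∀ t ∈ Icc 0 l, s ≤ t →
      ((α * h₁ t + β * h₂ t) - (α * h₁ s + β * h₂ s)) ^ 2
      ≤ (t - s) * (-p₁ 0 * α ^ 2 + 2 * p₁ l * α * β + p₂ l * β ^ 2) := by
    intro s hs t ht hst
    refine (hu.sq_sub_le hl hq hq0 hs.1 hst ht.2).trans (le_of_eq ?_)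
    simp only [h.h₁_zero, h.h₁_len, h.h₂_zero, h.h₂_len, h.symm hl]
    ring
  rcases le_total s t with hst | hst
  · rw [abs_sub_comm, abs_of_nonneg (sub_nonneg.2 hst), ← neg_sq, neg_sub]
    exact key s hs t ht hst
  · rw [abs_of_nonneg (sub_nonneg.2 hst)]
    exact key t ht s hs hst

theorem energy_one_le (h : IsFundamental l q h₁ p₁ h₂ p₂) (hl : 0 ≤ l)
    (hq : IntegrableOn q (Ioo 0 l)) (hq0 : ∀ t, 0 ≤ q t) :
    -p₁ 0 + 2 * p₁ l + p₂ l ≤ ∫ x in (0 : ℝ)..l, q x := by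
  refine le_trans (le_of_eq ?_) ((h.sol₁.comb h.sol₂ 1 1).energy_le_integral hl hq hq0 ?_ ?_)
  all_goals simp only [h.h₁_zero, h.h₁_len, h.h₂_zero, h.h₂_len, h.symm hl]
  all_goals ring

end IsFundamental

namespace MetricGraph

variable {V : Type*} {M : MetricGraph V}

/-! ### Points and paths -/

theorem source_ne_target (e : M.Edge) : M.source e ≠ M.target e := by
  intro h
  have h1 := mk_source_target e
  have h2 : s(M.source e, M.target e) ∈ M.graph.edgeSet := by rw [h1]; exact e.2
  rw [h] at h2
  exact M.graph.loopless.irrefl _ h2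

theorem adj_source_target (e : M.Edge) : M.graph.Adj (M.source e) (M.target e) := by
  have h1 := mk_source_target e
  have h2 : s(M.source e, M.target e) ∈ M.graph.edgeSet := by rw [h1]; exact e.2
  exact h2

theorem mem_incident_iff {v : V} {e : M.Edge} :
    e ∈ M.incident v ↔ v = M.source e ∨ v = M.target e := by
  change v ∈ e.1 ↔ _
  rw [← mk_source_target e, Sym2.mem_iff]

theorem zero_mem (e : M.Edge) : (0 : ℝ) ∈ Icc 0 (M.len e) := ⟨le_rfl, (M.len_pos e).le⟩

theorem len_mem (e : M.Edge) : M.len e ∈ Icc 0 (M.len e) := ⟨(M.len_pos e).le, le_rfl⟩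

theorem param_cases {e : M.Edge} {s : ℝ} (hs : s ∈ Icc 0 (M.len e)) :
    s = 0 ∨ s = M.len e ∨ s ∈ Ioo 0 (M.len e) := by
  rcases hs.1.eq_or_lt with h | h
  · exact .inl h.symm
  rcases hs.2.eq_or_lt with h' | h'
  · exact .inr (.inl h')
  · exact .inr (.inr ⟨h, h'⟩)

theorem edgePoint_eq_inner {e e' : M.Edge} {s s' : ℝ} (hs : s ∈ Icc 0 (M.len e))
    (hs' : s' ∈ Ioo 0 (M.len e')) (h : M.edgePoint e s = M.edgePoint e' s') : e = e' ∧ s = s' := by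
  rw [edgePoint_inner e' s' hs'] at h
  rcases param_cases hs with rfl | rfl | h0
  · rw [edgePoint_zero] at h; cases h
  · rw [edgePoint_len] at h; cases h
  · rw [edgePoint_inner e s h0] at h
    cases h
    exact ⟨rfl, rfl⟩

theorem edgePoint_eq_vertex {e : M.Edge} {s : ℝ} (hs : s ∈ Icc 0 (M.len e)) {v : V}
    (h : M.edgePoint e s = .vertex v) :
    (s = 0 ∧ v = M.source e) ∨ (s = M.len e ∧ v = M.target e) := by
  rcases param_cases hs with rfl | rfl | h0
  · rw [edgePoint_zero] at h; cases h; exact .inl ⟨rfl, rfl⟩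
  · rw [edgePoint_len] at h; cases h; exact .inr ⟨rfl, rfl⟩
  · rw [edgePoint_inner e s h0] at h; cases h

theorem edgePoint_injOn (e : M.Edge) : InjOn (M.edgePoint e) (Icc 0 (M.len e)) := by
  intro s hs t ht h
  rcases param_cases ht with rfl | rfl | h0
  · rw [edgePoint_zero] at h
    rcases edgePoint_eq_vertex hs h with ⟨h1, -⟩ | ⟨-, h1⟩
    · exact h1
    · exact absurd h1 (source_ne_target e)
  · rw [edgePoint_len] at h
    rcases edgePoint_eq_vertex hs h with ⟨-, h1⟩ | ⟨h1, -⟩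
    · exact absurd h1.symm (source_ne_target e)
    · exact h1
  · exact (edgePoint_eq_inner hs h0 h).2

theorem HasPath.dist_le {x y : M.Point} {r : ℝ} (h : M.HasPath x y r) : dist x y ≤ r :=
  csInf_le (bddBelow_hasPath x y) h

theorem exists_hasPath_lt {x y : M.Point} {r : ℝ} (h : dist x y < r) :
    ∃ r' < r, M.HasPath x y r' := by
  obtain ⟨r', h1, h2⟩ := exists_lt_of_csInf_lt (exists_hasPath x y) h
  exact ⟨r', h2, h1⟩

/-- A path that starts on `e` either stays there or leaves through an end of `e`, and then it has
already paid for the way to that end. Starting at an end itself makes the claim trivial, so the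
induction hypothesis is used only at interior points. -/
theorem HasPath.edge_cases {x y : M.Point} {r : ℝ} (h : M.HasPath x y r) :
    ∀ (e : M.Edge) (s : ℝ), s ∈ Icc 0 (M.len e) → x = M.edgePoint e s →
      (∃ t ∈ Icc 0 (M.len e), y = M.edgePoint e t ∧ |s - t| ≤ r) ∨
      s + dist (.vertex (M.source e)) y ≤ r ∨
      (M.len e - s) + dist (.vertex (M.target e)) y ≤ r := by
  induction h with
  | nil x => exact fun e s hs hx => .inl ⟨s, hs, hx, by simp⟩
  | cons e' s' t' hs' ht' y r h ih =>
    intro e s hs hx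
    have hp := (HasPath.cons e' s' t' hs' ht' y r h).dist_le
    rcases param_cases hs with rfl | rfl | h0
    · rw [hx, edgePoint_zero] at hp
      exact .inr (.inl (by linarith))
    · rw [hx, edgePoint_len] at hp
      exact .inr (.inr (by linarith))
    · obtain ⟨rfl, rfl⟩ := edgePoint_eq_inner hs' h0 hx
      rcases ih _ t' ht' rfl with ⟨t, ht, hy, h1⟩ | h1 | h1
      · exact .inl ⟨t, ht, hy, (abs_sub_le s' t' t).trans (by linarith)⟩
      · exact .inr (.inl (by linarith [le_abs_self (s' - t')]))
      · exact .inr (.inr (by linarith [neg_abs_le (s' - t')]))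

/-- The alternatives of `edge_cases` survive the infimum: if all failed, some path would be shorter
than every available bound. This is the basic tool for the local geometry of the graph. -/
theorem dist_edge_cases (e : M.Edge) {s : ℝ} (hs : s ∈ Icc 0 (M.len e)) (y : M.Point) :
    (∃ t ∈ Icc 0 (M.len e), y = M.edgePoint e t ∧ |s - t| ≤ dist (M.edgePoint e s) y) ∨
      s + dist (.vertex (M.source e)) y ≤ dist (M.edgePoint e s) y ∨
      (M.len e - s) + dist (.vertex (M.target e)) y ≤ dist (M.edgePoint e s) y := by
  by_contra! hcon
  obtain ⟨h1, h2, h3⟩ := hcon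
  by_cases hy : ∃ t ∈ Icc 0 (M.len e), y = M.edgePoint e t
  · obtain ⟨t, ht, hyt⟩ := hy
    obtain ⟨r, hr, hp⟩ := exists_hasPath_lt (lt_min (h1 t ht hyt) (lt_min h2 h3))
    rw [lt_min_iff, lt_min_iff] at hr
    rcases hp.edge_cases e s hs rfl with ⟨t', ht', hy', h4⟩ | h4 | h4
    · have := edgePoint_injOn e ht ht' (hyt.symm.trans hy')
      subst this
      linarith [hr.1]
    · linarith [hr.2.1]
    · linarith [hr.2.2]
  · push Not at hy
    obtain ⟨r, hr, hp⟩ := exists_hasPath_lt (lt_min h2 h3)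
    rw [lt_min_iff] at hr
    rcases hp.edge_cases e s hs rfl with ⟨t', ht', hy', h4⟩ | h4 | h4
    · exact hy t' ht' hy'
    · linarith [hr.1]
    · linarith [hr.2]

/-! ### Walks -/

variable (M) in
open Classical in
/-- The value of an edge function at an unordered pair of vertices, `0` for nonadjacent ones. -/
noncomputable def onPair (f : M.Edge → ℝ) (z : Sym2 V) : ℝ :=
  if h : z ∈ M.graph.edgeSet then f ⟨z, h⟩ else 0

theorem onPair_edge (f : M.Edge → ℝ) (e : M.Edge) : M.onPair f e.1 = f e := by
  simp only [onPair, dif_pos e.2]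

theorem onPair_source_target (f : M.Edge → ℝ) (e : M.Edge) :
    M.onPair f s(M.source e, M.target e) = f e := by
  rw [mk_source_target, onPair_edge]

theorem onPair_nonneg {f : M.Edge → ℝ} (hf : ∀ e, 0 ≤ f e) (z : Sym2 V) : 0 ≤ M.onPair f z := by
  unfold onPair
  split_ifs
  exacts [hf _, le_rfl]

variable (M) in
/-- The length of a walk. -/
noncomputable def walkLen {v w : V} (p : M.graph.Walk v w) : ℝ := (p.edges.map (M.onPair M.len)).sum

theorem walkLen_nonneg {v w : V} (p : M.graph.Walk v w) : 0 ≤ M.walkLen p := by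
  refine List.sum_nonneg fun x hx => ?_
  obtain ⟨z, -, rfl⟩ := List.mem_map.1 hx
  exact onPair_nonneg (fun e => (M.len_pos e).le) z

/-- Paths between vertices may turn back inside edges, so the induction must also follow points in
the interior of an edge. For these it records through which end the walk continues and counts the
cost of reaching that end. -/
theorem HasPath.exists_walk {x y : M.Point} {r : ℝ} (h : M.HasPath x y r) (w : V) :
    y = .vertex w →
    (∀ (e : M.Edge) (s : ℝ), s ∈ Icc 0 (M.len e) → x = M.edgePoint e s →
      (∃ p : M.graph.Walk (M.source e) w, s + M.walkLen p ≤ r) ∨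
      (∃ p : M.graph.Walk (M.target e) w, M.len e - s + M.walkLen p ≤ r)) ∧
    ∀ v, x = .vertex v → ∃ p : M.graph.Walk v w, M.walkLen p ≤ r := by
  induction h with
  | nil x =>
    rintro rfl
    refine ⟨fun e s hs hx => ?_, fun v hv => ?_⟩
    · rcases edgePoint_eq_vertex hs hx.symm with ⟨rfl, rfl⟩ | ⟨rfl, rfl⟩
      · exact .inl ⟨.nil, by simp [walkLen]⟩
      · exact .inr ⟨.nil, by simp [walkLen]⟩
    · cases hv
      exact ⟨.nil, by simp [walkLen]⟩
  | cons e' s' t' hs' ht' y r h ih =>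
    intro hy
    have hA : (∃ p : M.graph.Walk (M.source e') w, s' + M.walkLen p ≤ |s' - t'| + r) ∨
        (∃ p : M.graph.Walk (M.target e') w, M.len e' - s' + M.walkLen p ≤ |s' - t'| + r) := by
      rcases (ih hy).1 e' t' ht' rfl with ⟨p, hp⟩ | ⟨p, hp⟩
      · exact .inl ⟨p, by linarith [le_abs_self (s' - t')]⟩
      · exact .inr ⟨p, by linarith [neg_abs_le (s' - t')]⟩
    -- If the walk found continues from the far end of the edge, the whole edge is prepended to it.
    have hB : ∀ v, M.edgePoint e' s' = .vertex v →
        ∃ p : M.graph.Walk v w, M.walkLen p ≤ |s' - t'| + r := by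
      intro v hv
      rcases edgePoint_eq_vertex hs' hv with ⟨h0, rfl⟩ | ⟨h0, rfl⟩ <;>
        rcases hA with ⟨p, hp⟩ | ⟨p, hp⟩
      · exact ⟨p, by linarith⟩
      · refine ⟨.cons (adj_source_target e') p, ?_⟩
        simp only [walkLen, SimpleGraph.Walk.edges_cons, List.map_cons, List.sum_cons,
          onPair_source_target] at hp ⊢
        linarith
      · refine ⟨.cons (adj_source_target e').symm p, ?_⟩
        simp only [walkLen, SimpleGraph.Walk.edges_cons, List.map_cons, List.sum_cons] at hp ⊢
        rw [Sym2.eq_swap, onPair_source_target]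
        linarith
      · exact ⟨p, by linarith⟩
    refine ⟨fun e s hs hx => ?_, hB⟩
    rcases param_cases hs with rfl | rfl | h0
    · obtain ⟨p, hp⟩ := hB (M.source e) (by rw [hx, edgePoint_zero])
      exact .inl ⟨p, by linarith⟩
    · obtain ⟨p, hp⟩ := hB (M.target e) (by rw [hx, edgePoint_len])
      exact .inr ⟨p, by linarith⟩
    · obtain ⟨rfl, rfl⟩ := edgePoint_eq_inner hs' h0 hx
      exact hA

theorem exists_walk_lt {v w : V} {r : ℝ} (h : dist (.vertex v : M.Point) (.vertex w) < r) :
    ∃ p : M.graph.Walk v w, M.walkLen p < r := by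
  obtain ⟨r', hr', hp⟩ := exists_hasPath_lt h
  obtain ⟨p, hp⟩ := (hp.exists_walk w rfl).2 v rfl
  exact ⟨p, hp.trans_lt hr'⟩

/-! ### Local structure -/

theorem finite_incident (v : V) : (M.incident v).Finite := by
  have h := (M.locallyFinite v).image fun w => s(v, w)
  refine Finite.of_injOn (f := Subtype.val) (t := (fun w => s(v, w)) '' M.graph.neighborSet v)
    (fun e he => ?_) Subtype.val_injective.injOn h
  obtain ⟨w, hw⟩ := Sym2.mem_iff_exists.1 (show v ∈ e.1 from he)
  refine ⟨w, ?_, hw.symm⟩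
  have := e.2
  rw [hw] at this
  exact this

theorem exists_pos_le_len (v : V) : ∃ ε > 0, ∀ e ∈ M.incident v, ε ≤ M.len e := by
  have : ∀ᶠ ε in 𝓝[>] (0 : ℝ), ∀ e ∈ M.incident v, ε ≤ M.len e :=
    (eventually_all_finite (finite_incident v)).2 fun e _ =>
      mem_nhdsWithin_of_mem_nhds (Iic_mem_nhds (M.len_pos e))
  obtain ⟨ε, h1, h2⟩ := (this.and self_mem_nhdsWithin).exists
  exact ⟨ε, h2, h1⟩

/-- The first edge of any walk that leaves `v` already has length at least `ε`. -/
theorem le_dist_vertex {v w : V} (hvw : v ≠ w) {ε : ℝ} (hε : ∀ e ∈ M.incident v, ε ≤ M.len e) :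
    ε ≤ dist (.vertex v : M.Point) (.vertex w) := by
  by_contra! h
  obtain ⟨p, hp⟩ := exists_walk_lt h
  cases p with
  | nil => exact hvw rfl
  | @cons _ x _ hadj p =>
    have h1 := hε ⟨s(v, x), hadj⟩ (Sym2.mem_mk_left v x)
    have h2 := onPair_edge M.len ⟨s(v, x), hadj⟩
    have h3 := walkLen_nonneg p
    simp only [walkLen, SimpleGraph.Walk.edges_cons, List.map_cons, List.sum_cons] at hp h3
    simp only at h2
    linarith

theorem isCompact_edge (e : M.Edge) : IsCompact (M.edgePoint e '' Icc 0 (M.len e)) :=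
  isCompact_Icc.image (M.continuous_edgePoint e)

/-- Local compactness: a small ball about a vertex lies in the finite union of closed edges at it,
and one about an inner point lies in its edge. -/
theorem exists_compact_nhd (x : M.Point) : ∃ ε > 0, ∃ K : Set M.Point, IsCompact K ∧
    (∀ y, dist y x < ε → y ∈ K) ∧ ∀ v, dist (.vertex v) x < ε → x = .vertex v := by
  rcases x with v | ⟨e, s, hs⟩
  · obtain ⟨ε, hε, hlen⟩ := exists_pos_le_len (M := M) v
    refine ⟨ε, hε, {.vertex v} ∪ ⋃ e ∈ M.incident v, M.edgePoint e '' Icc 0 (M.len e),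
      isCompact_singleton.union ((finite_incident v).isCompact_biUnion fun e _ => isCompact_edge e),
      ?_, ?_⟩
    · rintro (w | ⟨e, s, hs⟩) hy
      · by_cases h : v = w
        · subst h
          exact .inl rfl
        · rw [dist_comm] at hy
          exact absurd (le_dist_vertex h hlen) (not_le.2 hy)
      · refine .inr ?_
        have hs' := Ioo_subset_Icc_self hs
        rw [← edgePoint_inner] at hy ⊢
        suffices he : e ∈ M.incident v from mem_biUnion he ⟨s, hs', rfl⟩
        rw [mem_incident_iff]
        rcases dist_edge_cases e hs' (.vertex v) with ⟨t, ht, h1, -⟩ | h1 | h1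
        · exact (edgePoint_eq_vertex ht h1.symm).imp And.right And.right
        · refine .inl (by_contra fun h => ?_)
          have := le_dist_vertex h hlen
          rw [dist_comm] at this
          linarith [hs.1]
        · refine .inr (by_contra fun h => ?_)
          have := le_dist_vertex h hlen
          rw [dist_comm] at this
          linarith [hs.2]
    · intro w hw
      by_contra h
      have h' : v ≠ w := fun h' => h (by rw [h'])
      rw [dist_comm] at hw
      exact absurd (le_dist_vertex h' hlen) (not_le.2 hw)
  · have hs' := Ioo_subset_Icc_self hs
    have key : ∀ y, dist y (.inner e s hs) < min s (M.len e - s) →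
        ∃ t ∈ Ioo 0 (M.len e), y = M.edgePoint e t := by
      intro y hy
      rw [dist_comm, ← edgePoint_inner, lt_min_iff] at hy
      have hn := fun v => dist_nonneg (x := (.vertex v : M.Point)) (y := y)
      rcases dist_edge_cases e hs' y with ⟨t, ht, h1, h2⟩ | h1 | h1
      · refine ⟨t, ⟨?_, ?_⟩, h1⟩
        · linarith [le_abs_self (s - t)]
        · linarith [neg_abs_le (s - t)]
      · linarith [hn (M.source e)]
      · linarith [hn (M.target e)]
    refine ⟨min s (M.len e - s), lt_min hs.1 (sub_pos.2 hs.2), _, isCompact_edge e, ?_, ?_⟩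
    · intro y hy
      obtain ⟨t, ht, rfl⟩ := key y hy
      exact ⟨t, Ioo_subset_Icc_self ht, rfl⟩
    · intro v hv
      obtain ⟨t, ht, h⟩ := key _ hv
      rw [edgePoint_inner e t ht] at h
      cases h

/-! ### The completion -/

variable (M) in
/-- The vertices as points of the completion. -/
noncomputable def vtx (v : V) : M.Compl := ((Point.vertex v : M.Point) : M.Compl)

theorem dist_vtx (v w : V) : dist (M.vtx v) (M.vtx w) = dist (.vertex v : M.Point) (.vertex w) :=
  UniformSpace.Completion.dist_eq _ _

/-- The graph is open in its completion and vertices are isolated among vertices. The trace of a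
small ball on the dense graph lies in a compact set, which stays closed in the completion and so
contains the ball. -/
theorem exists_nhd_compl (x : M.Point) : ∃ ε > 0,
    (∀ b : M.Compl, dist b x < ε → b ∈ range ((↑) : M.Point → M.Compl)) ∧
    ∀ v, dist (M.vtx v) x < ε → x = .vertex v := by
  obtain ⟨ε, hε, K, hK, h1, h2⟩ := exists_compact_nhd x
  refine ⟨ε, hε, fun b hb => ?_, fun v hv => h2 v ?_⟩
  · have hcl : b ∈ closure (Metric.ball (x : M.Compl) ε ∩ range ((↑) : M.Point → M.Compl)) :=
      UniformSpace.Completion.denseRange_coe.open_subset_closure_inter Metric.isOpen_ball hb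
    have hsub : Metric.ball (x : M.Compl) ε ∩ range ((↑) : M.Point → M.Compl) ⊆
        ((↑) : M.Point → M.Compl) '' K := by
      rintro _ ⟨hy, y, rfl⟩
      rw [Metric.mem_ball, UniformSpace.Completion.dist_eq] at hy
      exact ⟨y, h1 y hy, rfl⟩
    have hKc := (hK.image (UniformSpace.Completion.continuous_coe M.Point)).isClosed
    obtain ⟨y, -, rfl⟩ := hKc.closure_subset_iff.2 hsub hcl
    exact ⟨y, rfl⟩
  · rwa [vtx, UniformSpace.Completion.dist_eq] at hv

theorem vtx_injective : Function.Injective M.vtx := by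
  intro v w h
  obtain ⟨ε, hε, -, h2⟩ := exists_nhd_compl (.vertex v : M.Point)
  have := h2 w (by rw [← h]; simpa [vtx] using hε)
  cases this
  rfl

theorem isClosed_boundary : IsClosed M.boundary := by
  rw [← isOpen_compl_iff, Metric.isOpen_iff]
  intro x hx
  rw [boundary, compl_union, compl_compl] at hx
  obtain ⟨hx1, p, rfl⟩ := hx
  obtain ⟨ε, hε, h1, h2⟩ := exists_nhd_compl p
  refine ⟨ε, hε, fun b hb hb' => ?_⟩
  rcases hb' with ⟨v, hv, rfl⟩ | hb'
  · exact hx1 ⟨v, hv, by rw [h2 v hb]⟩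
  · exact hb' (h1 b hb)

theorem vtx_mem_boundary_iff {v : V} : M.vtx v ∈ M.boundary ↔ (M.incident v).ncard = 1 := by
  constructor
  · rintro (⟨w, hw, h⟩ | h)
    · rwa [vtx_injective (show M.vtx v = M.vtx w from h)]
    · exact absurd ⟨_, rfl⟩ h
  · exact fun h => .inl ⟨v, h, rfl⟩

/-- Points of the completion outside the graph are limits of vertices. -/
theorem exists_vtx_dist_lt {b : M.Compl} (hb : b ∉ range ((↑) : M.Point → M.Compl)) {ε : ℝ}
    (hε : 0 < ε) : ∃ v, dist (M.vtx v) b < ε := by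
  by_contra! hcon
  obtain ⟨x, hx⟩ := UniformSpace.Completion.denseRange_coe.exists_dist_lt b (show 0 < ε / 3 by
    positivity)
  rcases x with v | ⟨e, s, hs⟩
  · have := hcon v
    rw [dist_comm] at this
    change dist b (M.vtx v) < _ at hx
    linarith
  rw [← edgePoint_inner] at hx
  have hs' := Ioo_subset_Icc_self hs
  -- Without vertices near `b`, a short path between graph points near `b` cannot leave `e`. The
  -- graph near `b` thus lies in one compact edge, which would contain `b`.
  have hsub : Metric.ball b (ε / 3) ∩ range ((↑) : M.Point → M.Compl) ⊆
      ((↑) : M.Point → M.Compl) '' (M.edgePoint e '' Icc 0 (M.len e)) := by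
    rintro _ ⟨hy, y, rfl⟩
    rw [Metric.mem_ball] at hy
    have hd : dist (M.edgePoint e s) y < 2 * ε / 3 := by
      rw [← UniformSpace.Completion.dist_eq]
      have := dist_triangle_left ((M.edgePoint e s : M.Point) : M.Compl) y b
      rw [dist_comm b] at this
      linarith [dist_comm (y : M.Compl) b, dist_comm b ((M.edgePoint e s : M.Point) : M.Compl)]
    have hn := fun v => dist_nonneg (x := (.vertex v : M.Point)) (y := y)
    have hfar : ∀ v, dist (M.edgePoint e s) (.vertex v) ≤ dist (M.edgePoint e s) y → False := by
      intro v hv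
      have h1 := hcon v
      have h2 := dist_triangle_left (M.vtx v) b ((M.edgePoint e s : M.Point) : M.Compl)
      have h3 : dist ((M.edgePoint e s : M.Point) : M.Compl) (M.vtx v)
        = dist (M.edgePoint e s) (.vertex v) := UniformSpace.Completion.dist_eq _ _
      rw [dist_comm b] at hx
      linarith
    rcases dist_edge_cases e hs' y with ⟨t, ht, h1, -⟩ | h1 | h1
    · exact ⟨y, ⟨t, ht, h1.symm⟩, rfl⟩
    · refine (hfar (M.source e) ?_).elim
      have := M.dist_edgePoint_le e s 0
      rw [edgePoint_zero, sub_zero, abs_of_nonneg hs'.1] at this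
      linarith [hn (M.source e)]
    · refine (hfar (M.target e) ?_).elim
      have := M.dist_edgePoint_le e s (M.len e)
      rw [edgePoint_len, abs_sub_comm, abs_of_nonneg (sub_nonneg.2 hs'.2)] at this
      linarith [hn (M.target e)]
  have hcl : b ∈ closure (Metric.ball b (ε / 3) ∩ range ((↑) : M.Point → M.Compl)) :=
    UniformSpace.Completion.denseRange_coe.open_subset_closure_inter Metric.isOpen_ball
      (Metric.mem_ball_self (by positivity))
  have hKc := ((isCompact_edge e).image (UniformSpace.Completion.continuous_coe M.Point)).isClosed
  obtain ⟨y, -, rfl⟩ := hKc.closure_subset_iff.2 hsub hcl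
  exact hb ⟨y, rfl⟩

/-- Boundary values of vertex functions are limits along this filter. At an ideal point vertices
accumulate; at a boundary vertex, being isolated among vertices, the limit is just the value there.
-/
theorem comap_vtx_neBot {b : M.Compl} (hb : b ∈ M.boundary) : (comap M.vtx (𝓝 b)).NeBot := by
  rw [comap_neBot_iff]
  intro t ht
  rcases hb with ⟨v, -, rfl⟩ | hb
  · exact ⟨v, mem_of_mem_nhds ht⟩
  · obtain ⟨ε, hε, h⟩ := Metric.mem_nhds_iff.1 ht
    obtain ⟨v, hv⟩ := exists_vtx_dist_lt hb hε
    exact ⟨v, h hv⟩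

theorem eventually_ne_of_ne {b : M.Compl} {v : V} (h : M.vtx v ≠ b) :
    ∀ᶠ w in comap M.vtx (𝓝 b), w ≠ v := by
  have : ∀ᶠ y in 𝓝 b, y ≠ M.vtx v := isOpen_ne.mem_nhds h.symm
  filter_upwards [preimage_mem_comap this] with w hw hwv
  exact hw (by rw [hwv])

end MetricGraph

theorem List.sum_toFinset_le {ι : Type*} [DecidableEq ι] {f : ι → ℝ} (hf : ∀ i, 0 ≤ f i)
    (l : List ι) : ∑ i ∈ l.toFinset, f i ≤ (l.map f).sum := by
  induction l with
  | nil => simp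
  | cons a l ih =>
    rw [List.toFinset_cons, List.map_cons, List.sum_cons]
    by_cases h : a ∈ l.toFinset
    · rw [Finset.insert_eq_of_mem h]
      linarith [hf a]
    · rw [Finset.sum_insert h]
      linarith

/-! ### The discrete energy of functions on the vertices -/

namespace MetricGraph

variable {V : Type*} {M : MetricGraph V}

variable (M) in
/-- A choice of fundamental solutions of `u'' = q u` on every edge, for a positive integrable
`q`. -/
structure FundamentalData (q : M.Point → ℝ) where
  h₁ : M.Edge → ℝ → ℝ
  p₁ : M.Edge → ℝ → ℝ
  h₂ : M.Edge → ℝ → ℝ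
  p₂ : M.Edge → ℝ → ℝ
  pos : ∀ x, 0 < q x
  integrableOn : ∀ e, IntegrableOn (M.onEdge q e) (Ioo 0 (M.len e))
  summable : Summable fun e => ∫ t in (0 : ℝ)..M.len e, M.onEdge q e t
  fundamental : ∀ e, IsFundamental (M.len e) (M.onEdge q e) (h₁ e) (p₁ e) (h₂ e) (p₂ e)

namespace FundamentalData

variable {q : M.Point → ℝ} (D : M.FundamentalData q)

/-- The energy of the solution with boundary values `α`, `β` on the edge `e`. -/
def edgeEnergy (e : M.Edge) (α β : ℝ) : ℝ :=
  -D.p₁ e 0 * α ^ 2 + 2 * D.p₁ e (M.len e) * α * β + D.p₂ e (M.len e) * β ^ 2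

/-- The solution on the edge `e` with boundary values given by a function on the vertices. -/
noncomputable def sol (f : V → ℝ) (e : M.Edge) (t : ℝ) : ℝ :=
  f (M.source e) * D.h₁ e t + f (M.target e) * D.h₂ e t

/-- The derivative of `sol`. -/
noncomputable def solDeriv (f : V → ℝ) (e : M.Edge) (t : ℝ) : ℝ :=
  f (M.source e) * D.p₁ e t + f (M.target e) * D.p₂ e t

/-- The energy of the solution on the edge `e` with boundary values given by `f`. -/
noncomputable def energyAt (f : V → ℝ) (e : M.Edge) : ℝ := D.edgeEnergy e (f (M.source e)) (f (M.target e))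

/-- The total energy of a function on the vertices. -/
noncomputable def energy (f : V → ℝ) : ENNReal := ∑' e, ENNReal.ofReal (D.energyAt f e)

open Classical in
/-- The outward derivative of the solution with vertex values `f`. -/
noncomputable def flux (f : V → ℝ) (v : V) (e : M.Edge) : ℝ :=
  if v = M.source e then D.solDeriv f e 0 else -D.solDeriv f e (M.len e)

theorem isSol_sol (f : V → ℝ) (e : M.Edge) :
    IsSol (M.len e) (M.onEdge q e) (D.sol f e) (D.solDeriv f e) :=
  (D.fundamental e).sol₁.comb (D.fundamental e).sol₂ _ _

theorem sol_zero (f : V → ℝ) (e : M.Edge) : D.sol f e 0 = f (M.source e) := by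
  simp [sol, (D.fundamental e).h₁_zero, (D.fundamental e).h₂_zero]

theorem sol_len (f : V → ℝ) (e : M.Edge) : D.sol f e (M.len e) = f (M.target e) := by
  simp [sol, (D.fundamental e).h₁_len, (D.fundamental e).h₂_len]

theorem sol_sq_sub_le (f : V → ℝ) (e : M.Edge) {s t : ℝ} (hs : s ∈ Icc 0 (M.len e))
    (ht : t ∈ Icc 0 (M.len e)) :
    (D.sol f e s - D.sol f e t) ^ 2 ≤ |s - t| * D.energyAt f e :=
  (D.fundamental e).sq_sub_le (M.len_pos e).le (D.integrableOn e) (fun _ => (D.pos _).le) _ _ hs ht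

theorem vertex_sq_sub_le (f : V → ℝ) (e : M.Edge) :
    (f (M.source e) - f (M.target e)) ^ 2 ≤ M.len e * D.energyAt f e := by
  have := D.sol_sq_sub_le f e (zero_mem e) (len_mem e)
  rwa [sol_zero, sol_len, zero_sub, abs_neg, abs_of_pos (M.len_pos e)] at this

theorem energyAt_nonneg (f : V → ℝ) (e : M.Edge) : 0 ≤ D.energyAt f e :=
  nonneg_of_mul_nonneg_right ((sq_nonneg _).trans (D.vertex_sq_sub_le f e)) (M.len_pos e)

theorem sum_energyAt_le {f : V → ℝ} {C : ℝ} (hC : 0 ≤ C) (hf : D.energy f ≤ ENNReal.ofReal C)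
    (T : Finset M.Edge) : ∑ e ∈ T, D.energyAt f e ≤ C := by
  rw [← ENNReal.ofReal_le_ofReal_iff hC,
    ENNReal.ofReal_sum_of_nonneg fun e _ => D.energyAt_nonneg f e]
  exact (ENNReal.sum_le_tsum T).trans hf

theorem energyAt_le {f : V → ℝ} {C : ℝ} (hC : 0 ≤ C) (hf : D.energy f ≤ ENNReal.ofReal C)
    (e : M.Edge) : D.energyAt f e ≤ C := by
  simpa using D.sum_energyAt_le hC hf {e}

theorem abs_sub_le_walk (f : V → ℝ) {v w : V} (p : M.graph.Walk v w) :
    |f v - f w| ≤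
      (p.edges.map (M.onPair fun e => |f (M.source e) - f (M.target e)|)).sum := by
  induction p with
  | nil => simp
  | @cons u v w h p ih =>
    rw [SimpleGraph.Walk.edges_cons, List.map_cons, List.sum_cons]
    have h1 : M.onPair (fun e => |f (M.source e) - f (M.target e)|) s(u, v) = |f u - f v| := by
      have h2 := onPair_edge (fun e => |f (M.source e) - f (M.target e)|) (⟨s(u, v), h⟩ : M.Edge)
      simp only at h2
      rw [h2]
      rcases Sym2.eq_iff.1 (mk_source_target (M := M) ⟨s(u, v), h⟩) with ⟨h3, h4⟩ | ⟨h3, h4⟩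
      · rw [h3, h4]
      · rw [h3, h4, abs_sub_comm]
    rw [h1]
    exact (abs_sub_le _ (f v) _).trans (by linarith)

/-- A function of finite energy is Hölder continuous on the vertices. -/
theorem sq_sub_le_dist {f : V → ℝ} {C : ℝ} (hC : 0 ≤ C) (hf : D.energy f ≤ ENNReal.ofReal C)
    (v w : V) : (f v - f w) ^ 2 ≤ C * dist (M.vtx v) (M.vtx w) := by
  classical
  have key : ∀ r, dist (M.vtx v) (M.vtx w) < r → (f v - f w) ^ 2 ≤ C * r := by
    intro r hr
    rw [dist_vtx] at hr
    obtain ⟨p, hp⟩ := exists_walk_lt hr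
    set δ := M.onPair fun e => |f (M.source e) - f (M.target e)|
    -- Loops are erased so that no edge repeats; only then are the edge energies along the walk
    -- bounded by the total energy.
    have h1 := abs_sub_le_walk f p.bypass
    rw [← List.sum_toFinset _ p.bypass_isPath.isTrail.edges_nodup] at h1
    set T := p.bypass.edges.toFinset
    have hT : ∀ z ∈ T, z ∈ M.graph.edgeSet := fun z hz =>
      p.bypass.edges_subset_edgeSet (List.mem_toFinset.1 hz)
    have h2 : ∑ z ∈ T, M.onPair M.len z ≤ r := by
      refine le_trans ?_ hp.le
      refine le_trans ?_ (List.sum_toFinset_le (onPair_nonneg fun e => (M.len_pos e).le) p.edges)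
      refine Finset.sum_le_sum_of_subset_of_nonneg (fun z hz => ?_)
        fun z _ _ => onPair_nonneg (fun e => (M.len_pos e).le) z
      exact List.mem_toFinset.2 (p.edges_bypass_subset_edges (List.mem_toFinset.1 hz))
    have h3 : ∑ z ∈ T, M.onPair (D.energyAt f) z ≤ C := by
      rw [← Finset.sum_subtype_of_mem _ hT]
      refine le_trans (le_of_eq ?_) (D.sum_energyAt_le hC hf (T.subtype (· ∈ M.graph.edgeSet)))
      exact Finset.sum_congr rfl fun e _ => onPair_edge (D.energyAt f) e
    -- Cauchy–Schwarz: on each edge the squared increment is at most energy times length.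
    have h4 : (∑ z ∈ T, δ z) ^ 2 ≤
        (∑ z ∈ T, M.onPair (D.energyAt f) z) * ∑ z ∈ T, M.onPair M.len z := by
      refine Finset.sum_sq_le_sum_mul_sum_of_sq_le_mul _
        (fun z _ => onPair_nonneg (D.energyAt_nonneg f) z)
        (fun z _ => onPair_nonneg (fun e => (M.len_pos e).le) z) fun z hz => ?_
      have e1 := onPair_edge (fun e => |f (M.source e) - f (M.target e)|) (⟨z, hT z hz⟩ : M.Edge)
      have e2 := onPair_edge (D.energyAt f) (⟨z, hT z hz⟩ : M.Edge)
      have e3 := onPair_edge M.len (⟨z, hT z hz⟩ : M.Edge)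
      simp only at e1 e2 e3
      rw [show δ z = _ from e1, e2, e3, sq_abs, mul_comm]
      exact D.vertex_sq_sub_le f _
    calc (f v - f w) ^ 2 = |f v - f w| ^ 2 := (sq_abs _).symm
      _ ≤ (∑ z ∈ T, δ z) ^ 2 := by gcongr
      _ ≤ _ := h4
      _ ≤ C * r := mul_le_mul h3 h2
          (Finset.sum_nonneg fun z _ => onPair_nonneg (fun e => (M.len_pos e).le) z) hC
  rcases hC.eq_or_lt with rfl | hC'
  · simpa using key _ (lt_add_one _)
  · rw [mul_comm, ← div_le_iff₀ hC']
    refine le_of_forall_gt_imp_ge_of_dense fun r hr => ?_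
    rw [div_le_iff₀ hC', mul_comm]
    exact key r hr

/-- A function of finite energy with boundary value `c` at `b` in the sense of limits. -/
theorem sq_sub_le_of_tendsto {f : V → ℝ} {C : ℝ} (hC : 0 ≤ C)
    (hf : D.energy f ≤ ENNReal.ofReal C) {b : M.Compl} (hb : b ∈ M.boundary) {c : ℝ}
    (hfc : Tendsto f (comap M.vtx (𝓝 b)) (𝓝 c)) (v : V) :
    (f v - c) ^ 2 ≤ C * dist (M.vtx v) b := by
  have := comap_vtx_neBot hb
  have h1 : Tendsto (fun w => (f v - f w) ^ 2) (comap M.vtx (𝓝 b)) (𝓝 ((f v - c) ^ 2)) :=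
    (tendsto_const_nhds.sub hfc).pow 2
  have h2 : Tendsto (fun w => C * dist (M.vtx v) (M.vtx w)) (comap M.vtx (𝓝 b))
      (𝓝 (C * dist (M.vtx v) b)) := (tendsto_const_nhds.dist tendsto_comap).const_mul C
  exact le_of_tendsto_of_tendsto' h1 h2 fun w => D.sq_sub_le_dist hC hf v w

end FundamentalData

/-! ### Flat functions on the vertices -/

variable (M) in
/-- A function on the vertices which is constant along all but finitely many edges. -/
def IsFlat (φ : V → ℝ) : Prop :=
  {e : M.Edge | φ (M.source e) ≠ φ (M.target e)}.Finite

/-- Follow a walk from `v` to `v₀`: the value changes only across the finitely many exceptional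
edges, so it is `φ v₀` or an end value of one of them. -/
theorem IsFlat.finite_range {φ : V → ℝ} (hφ : M.IsFlat φ) : (range φ).Finite := by
  obtain ⟨v₀⟩ := M.connected.nonempty
  set S := {e : M.Edge | φ (M.source e) ≠ φ (M.target e)}
  have hfin : ({φ v₀} ∪ ((fun e => φ (M.source e)) '' S ∪ (fun e => φ (M.target e)) '' S)).Finite :=
    (finite_singleton _).union ((hφ.image _).union (hφ.image _))
  refine hfin.subset ?_
  rintro _ ⟨v, rfl⟩
  obtain ⟨p⟩ := M.connected.preconnected v v₀
  clear hfin
  induction p with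
  | nil => exact .inl rfl
  | @cons u v w h p ih =>
    by_cases he : (⟨s(u, v), h⟩ : M.Edge) ∈ S
    · rcases Sym2.eq_iff.1 (mk_source_target (M := M) ⟨s(u, v), h⟩) with ⟨h3, h4⟩ | ⟨h3, h4⟩
      · exact .inr (.inl ⟨_, he, by simp only [h3]⟩)
      · exact .inr (.inr ⟨_, he, by simp only [h4]⟩)
    · have h1 : φ u = φ v := by
        have h2 := not_not.1 he
        rcases Sym2.eq_iff.1 (mk_source_target (M := M) ⟨s(u, v), h⟩) with ⟨h3, h4⟩ | ⟨h3, h4⟩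
        · rwa [h3, h4] at h2
        · rw [h3, h4] at h2
          exact h2.symm
      rw [h1]
      exact ih

theorem IsFlat.exists_bound {φ : V → ℝ} (hφ : M.IsFlat φ) : ∃ B, ∀ v, |φ v| ≤ B := by
  obtain ⟨B, hB⟩ := (hφ.finite_range.image abs).bddAbove
  exact ⟨B, fun v => hB ⟨_, ⟨v, rfl⟩, rfl⟩⟩

theorem IsFlat.op₂ {φ ψ : V → ℝ} (hφ : M.IsFlat φ) (hψ : M.IsFlat ψ) (op : ℝ → ℝ → ℝ) :
    M.IsFlat fun v => op (φ v) (ψ v) := by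
  refine (hφ.union hψ).subset fun e he => ?_
  by_contra h
  rw [mem_union, not_or] at h
  have h1 := not_not.1 h.1
  have h2 := not_not.1 h.2
  exact he (by simp only [h1, h2])

theorem isFlat_const (c : ℝ) : M.IsFlat fun _ => c := by
  simp [IsFlat]

/-- On an edge with equal end values the energy is at most `B² ∫ q`, by comparison with a constant.
These bounds are summable, and only finitely many other edges remain. -/
theorem FundamentalData.energy_lt_top {q : M.Point → ℝ} (D : M.FundamentalData q) {φ : V → ℝ}
    (hφ : M.IsFlat φ) : D.energy φ < ⊤ := by
  classical
  obtain ⟨B, hB⟩ := hφ.exists_bound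
  set S := hφ.toFinset with hS
  have h1 : ∀ e, ENNReal.ofReal (D.energyAt φ e) ≤
      (if e ∈ S then ENNReal.ofReal (D.energyAt φ e) else 0) +
        ENNReal.ofReal (B ^ 2 * ∫ t in (0 : ℝ)..M.len e, M.onEdge q e t) := by
    intro e
    by_cases he : e ∈ S
    · rw [if_pos he]
      exact le_self_add
    · rw [if_neg he, zero_add]
      refine ENNReal.ofReal_le_ofReal ?_
      have h2 : φ (M.source e) = φ (M.target e) := by
        by_contra h
        exact he (hφ.mem_toFinset.2 h)
      have h3 := (D.fundamental e).energy_one_le (M.len_pos e).le (D.integrableOn e)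
        fun _ => (D.pos _).le
      have h4 : 0 ≤ ∫ t in (0 : ℝ)..M.len e, M.onEdge q e t :=
        intervalIntegral.integral_nonneg (M.len_pos e).le fun _ _ => (D.pos _).le
      have h5 : φ (M.target e) ^ 2 ≤ B ^ 2 := sq_le_sq.2 ((hB _).trans (le_abs_self B))
      unfold FundamentalData.energyAt FundamentalData.edgeEnergy
      rw [h2]
      calc _ = φ (M.target e) ^ 2 * (-D.p₁ e 0 + 2 * D.p₁ e (M.len e) + D.p₂ e (M.len e)) := by
            ring
        _ ≤ φ (M.target e) ^ 2 * ∫ t in (0 : ℝ)..M.len e, M.onEdge q e t := by gcongr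
        _ ≤ _ := by gcongr
  refine (ENNReal.tsum_le_tsum h1).trans_lt ?_
  rw [ENNReal.tsum_add, ENNReal.add_lt_top]
  constructor
  · rw [tsum_eq_sum (s := S) fun e he => if_neg he]
    exact ENNReal.sum_lt_top.2 fun e he => by rw [if_pos he]; exact ENNReal.ofReal_lt_top
  · exact (D.summable.mul_left (B ^ 2)).tsum_ofReal_lt_top

/-! ### Minimizing the energy -/

namespace FundamentalData

variable {q : M.Point → ℝ} (D : M.FundamentalData q)

theorem energyAt_update_of_notMem [DecidableEq V] (f : V → ℝ) {v : V} (a : ℝ) {e : M.Edge}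
    (he : e ∉ M.incident v) : D.energyAt (Function.update f v a) e = D.energyAt f e := by
  rw [mem_incident_iff, not_or] at he
  simp only [energyAt, Function.update_of_ne (Ne.symm he.1), Function.update_of_ne (Ne.symm he.2)]

/-- There are no loops, so only one end value moves and the energy is quadratic in `t`. Its linear
coefficient is `-2` times the outward derivative, by the symmetry of the edge form. -/
theorem exists_energyAt_update [DecidableEq V] (f : V → ℝ) {v : V} {e : M.Edge}
    (he : e ∈ M.incident v) : ∃ c, ∀ t, D.energyAt (Function.update f v (f v + t)) e
      = D.energyAt f e - 2 * t * D.flux f v e + t ^ 2 * c := by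
  have hsymm := (D.fundamental e).symm (M.len_pos e).le
  rcases mem_incident_iff.1 he with rfl | rfl
  · refine ⟨-D.p₁ e 0, fun t => ?_⟩
    rw [flux, if_pos rfl]
    simp only [energyAt, edgeEnergy, solDeriv, Function.update_self,
      Function.update_of_ne (source_ne_target e).symm, hsymm]
    ring
  · refine ⟨D.p₂ e (M.len e), fun t => ?_⟩
    rw [flux, if_neg (source_ne_target e).symm]
    simp only [energyAt, edgeEnergy, solDeriv, Function.update_self,
      Function.update_of_ne (source_ne_target e)]
    ring

/-- Only the finite star of `v` feels the change; `R` is the energy of all other edges and does not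
depend on `t`. -/
theorem exists_energy_update [DecidableEq V] (f : V → ℝ) (v : V) : ∃ c : ℝ, ∃ R : ENNReal, ∀ t : ℝ,
    0 ≤ ∑ e ∈ (finite_incident v).toFinset, D.energyAt f e
        - 2 * t * (∑ e ∈ (finite_incident v).toFinset, D.flux f v e) + t ^ 2 * c ∧
    D.energy (Function.update f v (f v + t)) =
      ENNReal.ofReal (∑ e ∈ (finite_incident v).toFinset, D.energyAt f e
        - 2 * t * (∑ e ∈ (finite_incident v).toFinset, D.flux f v e) + t ^ 2 * c) + R := by
  classical
  set I := (finite_incident (M := M) v).toFinset with hI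
  choose! c hc using fun e (he : e ∈ M.incident v) => D.exists_energyAt_update f he
  refine ⟨∑ e ∈ I, c e, ∑' e : (I : Set M.Edge)ᶜ.Elem, ENNReal.ofReal (D.energyAt f e),
    fun t => ?_⟩
  have hsum : ∑ e ∈ I, D.energyAt (Function.update f v (f v + t)) e
      = ∑ e ∈ I, D.energyAt f e - 2 * t * (∑ e ∈ I, D.flux f v e) + t ^ 2 * ∑ e ∈ I, c e := by
    rw [Finset.mul_sum, Finset.mul_sum, ← Finset.sum_sub_distrib, ← Finset.sum_add_distrib]
    exact Finset.sum_congr rfl fun e he => hc e ((finite_incident v).mem_toFinset.1 he) t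
  rw [← hsum]
  refine ⟨Finset.sum_nonneg fun e _ => D.energyAt_nonneg _ e, ?_⟩
  rw [energy, ← ENNReal.sum_add_tsum_compl I]
  congr 1
  · rw [← ENNReal.ofReal_sum_of_nonneg fun e _ => D.energyAt_nonneg _ e]
  · refine tsum_congr fun e => ?_
    rw [D.energyAt_update_of_notMem f]
    exact fun h => e.2 ((finite_incident v).mem_toFinset.2 h)

theorem continuous_energyAt (e : M.Edge) : Continuous fun f : V → ℝ => D.energyAt f e := by
  unfold energyAt edgeEnergy
  fun_prop

theorem lowerSemicontinuous_energy : LowerSemicontinuous D.energy := by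
  unfold energy
  exact lowerSemicontinuous_tsum fun e =>
    (ENNReal.continuous_ofReal.comp (D.continuous_energyAt e)).lowerSemicontinuous

/-- In the product topology, a single boundary point already confines each value `f v` to a compact
interval, and the conditions are closed; Tychonoff does the rest. -/
theorem isCompact_holder (hne : M.boundary.Nonempty) (U : M.boundary → ℝ) (C : ℝ) :
    IsCompact {f : V → ℝ | ∀ b : M.boundary, ∀ v, (f v - U b) ^ 2 ≤ C * dist (M.vtx v) b} := by
  obtain ⟨b, hb⟩ := hne
  have hK : IsCompact (univ.pi fun v : V =>
      Icc (U ⟨b, hb⟩ - √(C * dist (M.vtx v) b)) (U ⟨b, hb⟩ + √(C * dist (M.vtx v) b))) :=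
    isCompact_univ_pi fun v => isCompact_Icc
  refine hK.of_isClosed_subset ?_ fun f hf v _ => ?_
  · simp only [Set.ofPred_forall]
    refine isClosed_iInter fun b => isClosed_iInter fun v => isClosed_le ?_ continuous_const
    fun_prop
  · have := abs_le.1 (Real.abs_le_sqrt (hf ⟨b, hb⟩ v))
    constructor <;> linarith [this.1, this.2]

theorem eq_zero_of_forall_small {a c : ℝ} (h : ∀ᶠ t in 𝓝 (0 : ℝ), 0 ≤ -2 * t * a + t ^ 2 * c) :
    a = 0 := by
  have hmin : IsLocalMin (fun t : ℝ => -2 * t * a + t ^ 2 * c) 0 := by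
    filter_upwards [h] with t ht
    simpa using ht
  have hd : HasDerivAt (fun t : ℝ => -2 * t * a + t ^ 2 * c) (-2 * a) 0 := by
    have h1 : HasDerivAt (fun t : ℝ => -2 * t * a) (-2 * a) 0 := by
      simpa using ((hasDerivAt_id (0 : ℝ)).const_mul (-2)).mul_const a
    have h2 : HasDerivAt (fun t : ℝ => t ^ 2 * c) 0 0 := by
      simpa using (hasDerivAt_pow 2 (0 : ℝ)).mul_const c
    exact (h1.fun_add h2).congr_deriv (add_zero _)
  have := hmin.hasDerivAt_eq_zero hd
  linarith

/-- The Dirichlet problem for boundary values of a flat function. -/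
theorem exists_minimizer (hne : M.boundary.Nonempty) {φ : V → ℝ} (hφ : M.IsFlat φ)
    (U : M.boundary → ℝ) (hU : ∀ b : M.boundary, Tendsto φ (comap M.vtx (𝓝 (b : M.Compl))) (𝓝 (U b))) :
    ∃ (f : V → ℝ) (C : ℝ), 0 ≤ C ∧ D.energy f ≤ ENNReal.ofReal C ∧
      (∀ (b : M.boundary) (v : V), (f v - U b) ^ 2 ≤ C * dist (M.vtx v) b) ∧
      ∀ v, M.vtx v ∉ M.boundary → ∑ e ∈ (finite_incident v).toFinset, D.flux f v e = 0 := by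
  classical
  have hE := D.energy_lt_top hφ
  set C₀ := (D.energy φ).toReal with hC₀
  have hC₀0 : 0 ≤ C₀ := ENNReal.toReal_nonneg
  have hEφ : D.energy φ = ENNReal.ofReal C₀ := (ENNReal.ofReal_toReal hE.ne).symm
  -- The boundary condition is encoded as a Hölder estimate because, unlike convergence at the
  -- boundary, it is closed under pointwise limits. The constant `C₀ + 1` in place of `C₀` leaves
  -- room for varying the minimizer.
  set K := {f : V → ℝ | ∀ b : M.boundary, ∀ v, (f v - U b) ^ 2 ≤ (C₀ + 1) * dist (M.vtx v) b}
  have hφK : φ ∈ K := fun b v => D.sq_sub_le_of_tendsto (by positivity)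
    (hEφ.le.trans (ENNReal.ofReal_le_ofReal (by linarith))) b.2 (hU b) v
  obtain ⟨f, hfK, hmin⟩ := D.lowerSemicontinuous_energy.lowerSemicontinuousOn K |>.exists_isMinOn
    ⟨φ, hφK⟩ (isCompact_holder hne U _)
  have hfE : D.energy f ≤ ENNReal.ofReal C₀ := (hmin hφK).trans hEφ.le
  refine ⟨f, C₀ + 1, by positivity, hfE.trans (ENNReal.ofReal_le_ofReal (by linarith)), hfK,
    fun v hv => ?_⟩
  obtain ⟨c, R, hR⟩ := D.exists_energy_update f v
  set A := ∑ e ∈ (finite_incident (M := M) v).toFinset, D.energyAt f e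
  set F := ∑ e ∈ (finite_incident (M := M) v).toFinset, D.flux f v e
  have hA : 0 ≤ A := Finset.sum_nonneg fun e _ => D.energyAt_nonneg f e
  have hR0 : D.energy f = ENNReal.ofReal A + R := by
    simpa using (hR 0).2
  have hRtop : R ≠ ⊤ := fun h => by
    rw [h, add_top] at hR0
    exact absurd (hR0 ▸ hfE) (by simp)
  have hfU : ∀ b : M.boundary, Tendsto f (comap M.vtx (𝓝 (b : M.Compl))) (𝓝 (U b)) := by
    intro b
    have h1 : Tendsto (fun w => √((C₀ + 1) * dist (M.vtx w) b)) (comap M.vtx (𝓝 (b : M.Compl)))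
        (𝓝 0) := by
      have h2 : Tendsto (fun w => dist (M.vtx w) (b : M.Compl)) (comap M.vtx (𝓝 (b : M.Compl)))
          (𝓝 0) := by
        simpa using (tendsto_comap (f := M.vtx) (x := 𝓝 (b : M.Compl))).dist
          (tendsto_const_nhds (x := (b : M.Compl)))
      simpa using (h2.const_mul (C₀ + 1)).sqrt
    rw [tendsto_iff_dist_tendsto_zero]
    exact squeeze_zero (fun w => dist_nonneg)
      (fun w => by rw [Real.dist_eq]; exact Real.abs_le_sqrt (hfK b w)) h1
  refine eq_zero_of_forall_small (c := c) ?_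
  have hsmall : ∀ᶠ t in 𝓝 (0 : ℝ), |-2 * t * F + t ^ 2 * c| < 1 := by
    have : Continuous fun t : ℝ => |-2 * t * F + t ^ 2 * c| := by fun_prop
    exact this.continuousAt.eventually (gt_mem_nhds (by simp))
  filter_upwards [hsmall] with t ht
  rw [abs_lt] at ht
  -- For small `t` the energy rises by less than 1, which stays within the slack built into `K`.
  have hgE : D.energy (Function.update f v (f v + t)) ≤ ENNReal.ofReal (C₀ + 1) := by
    rw [(hR t).2]
    calc _ ≤ ENNReal.ofReal (A + 1) + R := by
          refine add_le_add (ENNReal.ofReal_le_ofReal ?_) le_rfl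
          linarith [ht.2]
      _ = D.energy f + ENNReal.ofReal 1 := by
          rw [hR0, ENNReal.ofReal_add hA zero_le_one, add_right_comm]
      _ ≤ ENNReal.ofReal C₀ + ENNReal.ofReal 1 := by gcongr
      _ = _ := (ENNReal.ofReal_add hC₀0 zero_le_one).symm
  -- Changing one vertex off the boundary does not affect boundary limits, so the energy bound alone
  -- yields the Hölder estimate again.
  have hgK : Function.update f v (f v + t) ∈ K := by
    intro b w
    refine D.sq_sub_le_of_tendsto (by positivity) hgE b.2 ?_ w
    refine (hfU b).congr' ?_
    have hvb : M.vtx v ≠ b := fun h => hv (h ▸ b.2)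
    filter_upwards [eventually_ne_of_ne hvb] with w hw
    rw [Function.update_of_ne hw]
  have h1 : D.energy f ≤ _ := hmin hgK
  rw [(hR t).2, hR0, ENNReal.add_le_add_iff_right hRtop,
    ENNReal.ofReal_le_ofReal_iff (hR t).1] at h1
  linarith

end FundamentalData

end MetricGraph

namespace IsSol

theorem congr_left {l : ℝ} {q u v p : ℝ → ℝ} (hu : IsSol l q u p)
    (h : ∀ t ∈ Icc 0 l, v t = u t) : IsSol l q v p where
  hasDeriv t ht := (hu.hasDeriv t ht).congr h (h t ht)
  ac := hu.ac
  eqn := by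
    filter_upwards [hu.eqn, ae_restrict_mem measurableSet_Ioo] with t h1 h2
    rwa [h t (Ioo_subset_Icc_self h2)]

end IsSol

namespace MetricGraph

variable {V : Type*} {M : MetricGraph V} {q : M.Point → ℝ}

/-! ### Harmonic functions and solutions on the edges -/

theorem IsQHarmonic.isSol {u : M.Point → ℝ} (hu : M.IsQHarmonic q u) (e : M.Edge) :
    IsSol (M.len e) (M.onEdge q e) (M.onEdge u e) (M.edgeDeriv u e) where
  hasDeriv t ht := (hu.differentiableOn e t ht).hasDerivWithinAt
  ac := hu.absolutelyContinuous e
  eqn := hu.equation e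

theorem edgeDeriv_eq {u : M.Point → ℝ} {e : M.Edge} {p : ℝ → ℝ}
    (h : IsSol (M.len e) (M.onEdge q e) (M.onEdge u e) p) {t : ℝ} (ht : t ∈ Icc 0 (M.len e)) :
    M.edgeDeriv u e t = p t :=
  (h.hasDeriv t ht).derivWithin (uniqueDiffOn_Icc (M.len_pos e) t ht)

theorem outwardDeriv_eq {u : M.Point → ℝ} {e : M.Edge} {p : ℝ → ℝ}
    (h : IsSol (M.len e) (M.onEdge q e) (M.onEdge u e) p) (v : V) [Decidable (v = M.source e)] :
    M.outwardDeriv u v e = if v = M.source e then p 0 else -p (M.len e) := by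
  unfold outwardDeriv
  rw [edgeDeriv_eq h (zero_mem e), edgeDeriv_eq h (len_mem e)]
  congr

theorem isQHarmonic_of_isSol {u : M.Point → ℝ} {p : M.Edge → ℝ → ℝ}
    (h : ∀ e, IsSol (M.len e) (M.onEdge q e) (M.onEdge u e) (p e))
    (hv : ∀ v, 2 ≤ (M.incident v).ncard →
      ∑ e ∈ (finite_incident v).toFinset, M.outwardDeriv u v e = 0) : M.IsQHarmonic q u where
  differentiableOn e t ht := ((h e).hasDeriv t ht).differentiableWithinAt
  absolutelyContinuous e := (h e).ac.congr_of_eqOn fun t ht => by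
    rw [uIcc_of_le (M.len_pos e).le] at ht
    exact (edgeDeriv_eq (h e) ht).symm
  equation e := by
    filter_upwards [(h e).eqn, ae_restrict_mem measurableSet_Ioo] with t h1 h2
    refine h1.congr_of_eventuallyEq ?_
    filter_upwards [isOpen_Ioo.mem_nhds h2] with s hs
    exact edgeDeriv_eq (h e) (Ioo_subset_Icc_self hs)
  vertexCondition v h2 := by
    rw [finsum_mem_eq_finite_toFinset_sum _ (finite_incident v)]
    exact hv v h2

theorem IsQHarmonic.sum_outwardDeriv {u : M.Point → ℝ} (hu : M.IsQHarmonic q u) {v : V}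
    (hv : 2 ≤ (M.incident v).ncard) :
    ∑ e ∈ (finite_incident v).toFinset, M.outwardDeriv u v e = 0 := by
  rw [← finsum_mem_eq_finite_toFinset_sum _ (finite_incident v)]
  exact hu.vertexCondition v hv

theorem IsQHarmonic.comb {u v : M.Point → ℝ} (hu : M.IsQHarmonic q u) (hv : M.IsQHarmonic q v)
    (α β : ℝ) : M.IsQHarmonic q fun x => α * u x + β * v x := by
  classical
  have h : ∀ e, IsSol (M.len e) (M.onEdge q e) (M.onEdge (fun x => α * u x + β * v x) e)
      (fun t => α * M.edgeDeriv u e t + β * M.edgeDeriv v e t) := fun e =>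
    (hu.isSol e).comb (hv.isSol e) α β
  refine isQHarmonic_of_isSol h fun w hw => ?_
  have h1 : ∀ e, M.outwardDeriv (fun x => α * u x + β * v x) w e
      = α * M.outwardDeriv u w e + β * M.outwardDeriv v w e := by
    intro e
    rw [outwardDeriv_eq (h e), outwardDeriv_eq (hu.isSol e), outwardDeriv_eq (hv.isSol e)]
    split_ifs <;> ring
  simp_rw [h1, Finset.sum_add_distrib, ← Finset.mul_sum, hu.sum_outwardDeriv hw,
    hv.sum_outwardDeriv hw]
  simp

/-- By connectedness a vertex without edges would be the whole graph; a single point is complete,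
and its boundary is empty. -/
theorem incident_nonempty (hne : M.boundary.Nonempty) (v : V) : (M.incident v).Nonempty := by
  by_contra hemp
  rw [not_nonempty_iff_eq_empty] at hemp
  have hall : ∀ w, w = v := by
    intro w
    obtain ⟨p⟩ := M.connected.preconnected v w
    cases p with
    | nil => rfl
    | @cons _ x _ h p =>
      have : (⟨s(v, x), h⟩ : M.Edge) ∈ M.incident v := Sym2.mem_mk_left v x
      rw [hemp] at this
      exact this.elim
  have hpt : ∀ x : M.Point, x = .vertex v := by
    rintro (w | ⟨e, t, ht⟩)
    · rw [hall w]
    · have : e ∈ M.incident v := mem_incident_iff.2 (.inl (hall _).symm)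
      rw [hemp] at this
      exact this.elim
  have hrange : range ((↑) : M.Point → M.Compl) = {M.vtx v} := by
    ext y
    constructor
    · rintro ⟨x, rfl⟩
      rw [hpt x]
      rfl
    · rintro rfl
      exact ⟨_, rfl⟩
  have huniv : range ((↑) : M.Point → M.Compl) = univ := by
    have h1 := UniformSpace.Completion.denseRange_coe (α := M.Point)
    have h2 : IsClosed (range ((↑) : M.Point → M.Compl)) := by
      rw [hrange]
      exact isClosed_singleton
    rw [← h2.closure_eq]
    exact h1.closure_range
  obtain ⟨b, ⟨w, hw, -⟩ | hb⟩ := hne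
  · rw [hall w, hemp] at hw
    simp at hw
  · exact hb (huniv ▸ mem_univ b)

theorem two_le_ncard_incident (hne : M.boundary.Nonempty) {v : V} (hv : M.vtx v ∉ M.boundary) :
    2 ≤ (M.incident v).ncard := by
  have h1 : (M.incident v).ncard ≠ 1 := fun h => hv (vtx_mem_boundary_iff.2 h)
  have h2 := (ncard_pos (finite_incident v)).2 (incident_nonempty hne v)
  omega

/-- The maximum principle. -/
theorem le_of_le_boundary [CompactSpace M.Compl] (hne : M.boundary.Nonempty)
    (hq : ∀ e, IntegrableOn (M.onEdge q e) (Ioo 0 (M.len e))) (hq0 : ∀ x, 0 < q x)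
    {u : M.Compl → ℝ} (huc : Continuous u) (hu : M.IsQHarmonic q fun x : M.Point => u x) {m : ℝ}
    (hm : 0 ≤ m) (hb : ∀ b ∈ M.boundary, u b ≤ m) (x : M.Compl) : u x ≤ m := by
  obtain ⟨x₀, -, hx₀⟩ := isCompact_univ.exists_isMaxOn ⟨x, mem_univ x⟩ huc.continuousOn
  have hmax : ∀ y, u y ≤ u x₀ := fun y => hx₀ (mem_univ y)
  refine (hmax x).trans (not_lt.1 fun hlt => ?_)
  -- Here `0 ≤ m` is essential: the one-sided estimates apply only at a positive maximum.
  have hpos := hm.trans_lt hlt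
  have hx₀b : x₀ ∉ M.boundary := fun h => absurd (hb x₀ h) (not_le.2 hlt)
  have hrange : x₀ ∈ range ((↑) : M.Point → M.Compl) := by
    by_contra h
    exact hx₀b (.inr h)
  obtain ⟨p, rfl⟩ := hrange
  have hsrc : ∀ (e : M.Edge) (t : ℝ), 0 ≤ t → t < M.len e → M.edgePoint e t = p →
      M.edgeDeriv (fun x : M.Point => u x) e t < 0 := fun e t h0 h1 h2 =>
    (hu.isSol e).deriv_neg_of_max_right (M.len_pos e).le (hq e) (fun _ => hq0 _) hpos h0 h1
      (by simp only [onEdge, h2]) fun s _ => hmax _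
  have htgt : ∀ (e : M.Edge) (t : ℝ), 0 < t → t ≤ M.len e → M.edgePoint e t = p →
      0 < M.edgeDeriv (fun x : M.Point => u x) e t := fun e t h0 h1 h2 =>
    (hu.isSol e).deriv_pos_of_max_left (M.len_pos e).le (hq e) (fun _ => hq0 _) hpos h0 h1
      (by simp only [onEdge, h2]) fun s _ => hmax _
  -- At a vertex all outward derivatives are strictly negative, against the vertex condition; inside
  -- an edge the derivative would have both signs.
  rcases p with v | ⟨e, t, ht⟩
  · have h1 := hu.sum_outwardDeriv (two_le_ncard_incident hne hx₀b)
    obtain ⟨e₀, he₀⟩ := incident_nonempty hne v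
    refine absurd h1 (ne_of_lt (Finset.sum_neg (fun e he => ?_)
      ⟨e₀, (finite_incident v).mem_toFinset.2 he₀⟩))
    unfold outwardDeriv
    split_ifs with h
    · exact hsrc e 0 le_rfl (M.len_pos e) (by rw [edgePoint_zero, h])
    · have h2 := (mem_incident_iff.1 ((finite_incident v).mem_toFinset.1 he)).resolve_left h
      exact neg_neg_of_pos (htgt e _ (M.len_pos e) le_rfl (by rw [edgePoint_len, h2]))
  · have := hsrc e t ht.1.le ht.2 (edgePoint_inner e t ht)
    have := htgt e t ht.1 ht.2.le (edgePoint_inner e t ht)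
    linarith

theorem abs_sub_le_of_boundary [CompactSpace M.Compl] (hne : M.boundary.Nonempty)
    (hq : ∀ e, IntegrableOn (M.onEdge q e) (Ioo 0 (M.len e))) (hq0 : ∀ x, 0 < q x)
    {u v : M.Compl → ℝ} (huc : Continuous u) (hvc : Continuous v)
    (hu : M.IsQHarmonic q fun x : M.Point => u x) (hv : M.IsQHarmonic q fun x : M.Point => v x)
    {m : ℝ} (hm : 0 ≤ m) (hb : ∀ b ∈ M.boundary, |u b - v b| ≤ m) (x : M.Compl) :
    |u x - v x| ≤ m := by
  have h1 := le_of_le_boundary hne hq hq0 (u := fun x => 1 * u x + -1 * v x) (by fun_prop)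
    (hu.comb hv 1 (-1)) hm (fun b hb' => by linarith [(abs_le.1 (hb b hb')).2]) x
  have h2 := le_of_le_boundary hne hq hq0 (u := fun x => -1 * u x + 1 * v x) (by fun_prop)
    (hu.comb hv (-1) 1) hm (fun b hb' => by linarith [(abs_le.1 (hb b hb')).1]) x
  rw [abs_le]
  constructor <;> linarith

/-! ### Extending functions of finite energy to the completion -/

namespace FundamentalData

variable (D : M.FundamentalData q)

/-- The function on the graph which solves `u'' = q u` on the edges, with given values at the
vertices. -/
noncomputable def extend (f : V → ℝ) : M.Point → ℝ
  | .vertex v => f v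
  | .inner e t _ => D.sol f e t

theorem extend_edgePoint (f : V → ℝ) (e : M.Edge) {t : ℝ} (ht : t ∈ Icc 0 (M.len e)) :
    D.extend f (M.edgePoint e t) = D.sol f e t := by
  rcases param_cases ht with rfl | rfl | h
  · rw [edgePoint_zero, sol_zero]; rfl
  · rw [edgePoint_len, sol_len]; rfl
  · rw [edgePoint_inner e t h]; rfl

/-- The constant 3 counts the pieces of a route: from `x` to an end of its edge, from vertex to
vertex, and from an end of an edge to `y`. Each piece has length at most `dist x y`. -/
theorem abs_extend_sub_le {f : V → ℝ} {C : ℝ} (hC : 0 ≤ C) (hf : D.energy f ≤ ENNReal.ofReal C)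
    (x y : M.Point) : |D.extend f x - D.extend f y| ≤ 3 * √(C * dist x y) := by
  have hedge : ∀ (e : M.Edge) (s t r : ℝ), s ∈ Icc 0 (M.len e) → t ∈ Icc 0 (M.len e) →
      |s - t| ≤ r → |D.sol f e s - D.sol f e t| ≤ √(C * r) := by
    intro e s t r hs ht hr
    refine Real.abs_le_sqrt ((D.sol_sq_sub_le f e hs ht).trans ?_)
    rw [mul_comm]
    exact mul_le_mul (D.energyAt_le hC hf e) hr (abs_nonneg _) hC
  have hvert : ∀ (v w : V) (r : ℝ), dist (.vertex v : M.Point) (.vertex w) ≤ r →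
      |f v - f w| ≤ √(C * r) := by
    intro v w r hr
    refine Real.abs_le_sqrt ((D.sq_sub_le_dist hC hf v w).trans ?_)
    rw [dist_vtx]
    gcongr
  -- Passing from a vertex to a point of an edge costs one more piece; it is applied once for each
  -- of the two endpoints.
  have hstep : ∀ (k : ℝ) (y : M.Point), 0 ≤ k → (∀ (v : V) (r : ℝ),
      dist (.vertex v : M.Point) y ≤ r → |f v - D.extend f y| ≤ k * √(C * r)) →
      ∀ (e : M.Edge) (s r : ℝ), s ∈ Icc 0 (M.len e) → dist (M.edgePoint e s) y ≤ r →
      |D.sol f e s - D.extend f y| ≤ (k + 1) * √(C * r) := by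
    intro k y hk hvy e s r hs hr
    have hsq : 0 ≤ k * √(C * r) := by positivity
    have hn := fun v => dist_nonneg (x := (.vertex v : M.Point)) (y := y)
    rcases dist_edge_cases e hs y with ⟨t, ht, rfl, h2⟩ | h2 | h2
    · rw [extend_edgePoint D f e ht]
      have := hedge e s t r hs ht (h2.trans hr)
      linarith
    · have h3 := hvy (M.source e) r (by linarith [hs.1])
      have h4 := hedge e s 0 r hs (zero_mem e)
        (by rw [sub_zero, abs_of_nonneg hs.1]; linarith [hn (M.source e)])
      rw [sol_zero] at h4
      linarith [abs_sub_le (D.sol f e s) (f (M.source e)) (D.extend f y)]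
    · have h3 := hvy (M.target e) r (by linarith [hs.2])
      have h4 := hedge e s _ r hs (len_mem e)
        (by rw [abs_sub_comm, abs_of_nonneg (sub_nonneg.2 hs.2)]; linarith [hn (M.target e)])
      rw [sol_len] at h4
      linarith [abs_sub_le (D.sol f e s) (f (M.target e)) (D.extend f y)]
  have hvy : ∀ (y : M.Point) (v : V) (r : ℝ), dist (.vertex v : M.Point) y ≤ r →
      |f v - D.extend f y| ≤ 2 * √(C * r) := by
    intro y v r hr
    rcases y with w | ⟨e, t, ht⟩
    · refine (hvert v w r hr).trans ?_
      linarith [Real.sqrt_nonneg (C * r)]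
    · rw [abs_sub_comm]
      have := hstep 1 (.vertex v) zero_le_one (fun w r hr => by
        rw [one_mul]; exact hvert w v r hr) e t r (Ioo_subset_Icc_self ht)
        (by rwa [edgePoint_inner e t ht, dist_comm])
      rwa [one_add_one_eq_two] at this
  rcases x with v | ⟨e, t, ht⟩
  · refine (hvy y v _ le_rfl).trans ?_
    linarith [Real.sqrt_nonneg (C * dist (.vertex v : M.Point) y)]
  · have := hstep 2 y zero_le_two (hvy y) e t _ (Ioo_subset_Icc_self ht) le_rfl
    rw [edgePoint_inner e t ht] at this
    refine this.trans (le_of_eq ?_)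
    norm_num

theorem uniformContinuous_extend {f : V → ℝ} {C : ℝ} (hC : 0 ≤ C)
    (hf : D.energy f ≤ ENNReal.ofReal C) : UniformContinuous (D.extend f) := by
  rw [Metric.uniformContinuous_iff]
  intro ε hε
  have hc : Continuous fun t : ℝ => 3 * √(C * t) := by fun_prop
  have h1 : ∀ᶠ t in 𝓝 (0 : ℝ), 3 * √(C * t) < ε :=
    hc.continuousAt.eventually (gt_mem_nhds (by simpa using hε))
  obtain ⟨δ, hδ, h2⟩ := Metric.eventually_nhds_iff.1 h1
  refine ⟨δ, hδ, fun x y hxy => ?_⟩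
  rw [Real.dist_eq]
  exact (D.abs_extend_sub_le hC hf x y).trans_lt (h2 (by simpa [abs_of_nonneg dist_nonneg] using hxy))

/-- The functions on the completion which are harmonic on the graph, in terms of their values at
the vertices. -/
structure IsHarmonic (u : M.Compl → ℝ) : Prop where
  eq_sol : ∀ (e : M.Edge), ∀ t ∈ Icc 0 (M.len e),
    u (M.edgePoint e t : M.Point) = D.sol (fun v => u (M.vtx v)) e t
  sum_flux : ∀ v, M.vtx v ∉ M.boundary →
    ∑ e ∈ (finite_incident v).toFinset, D.flux (fun v => u (M.vtx v)) v e = 0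

variable {D}

theorem IsHarmonic.isQHarmonic {u : M.Compl → ℝ} (hu : D.IsHarmonic u) :
    M.IsQHarmonic q fun x : M.Point => u x := by
  classical
  have h : ∀ e, IsSol (M.len e) (M.onEdge q e) (M.onEdge (fun x : M.Point => u x) e)
      (D.solDeriv (fun v => u (M.vtx v)) e) := fun e =>
    (D.isSol_sol _ e).congr_left (hu.eq_sol e)
  refine isQHarmonic_of_isSol h fun v hv => ?_
  rw [← hu.sum_flux v fun hb => by rw [vtx_mem_boundary_iff.1 hb] at hv; omega]
  refine Finset.sum_congr rfl fun e _ => ?_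
  rw [outwardDeriv_eq (h e), flux]

variable (D)

/-- Expressed through vertex values, harmonicity is a family of linear equations each involving
finitely many values of `u`, so it passes to limits without control of derivatives. -/
theorem isClosed_isHarmonic [CompactSpace M.Compl] :
    IsClosed {u : C(M.Compl, ℝ) | D.IsHarmonic u} := by
  have heval : ∀ x : M.Compl, Continuous fun u : C(M.Compl, ℝ) => u x := fun x =>
    ContinuousEvalConst.continuous_eval_const x
  have h1 : {u : C(M.Compl, ℝ) | D.IsHarmonic u} =
      (⋂ e : M.Edge, ⋂ t ∈ Icc 0 (M.len e), {u : C(M.Compl, ℝ) |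
        u (M.edgePoint e t : M.Point) = D.sol (fun v => u (M.vtx v)) e t}) ∩
      ⋂ v : V, ⋂ _ : M.vtx v ∉ M.boundary, {u : C(M.Compl, ℝ) |
        ∑ e ∈ (finite_incident v).toFinset, D.flux (fun v => u (M.vtx v)) v e = 0} := by
    ext u
    simp only [mem_inter_iff, mem_iInter]
    exact ⟨fun h => ⟨h.1, h.2⟩, fun h => ⟨h.1, h.2⟩⟩
  rw [h1]
  refine IsClosed.inter (isClosed_iInter fun e => isClosed_biInter fun t _ => ?_)
    (isClosed_iInter fun v => isClosed_iInter fun _ => ?_)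
  · refine isClosed_eq (heval _) ?_
    exact ((heval _).mul continuous_const).add ((heval _).mul continuous_const)
  · refine isClosed_eq (continuous_finsetSum _ fun e _ => ?_) continuous_const
    have h2 : ∀ t, Continuous fun u : C(M.Compl, ℝ) => D.solDeriv (fun v => u (M.vtx v)) e t :=
      fun t => ((heval _).mul continuous_const).add ((heval _).mul continuous_const)
    unfold flux
    split_ifs
    exacts [h2 0, (h2 _).neg]

/-- Boundary values of flat functions have harmonic extensions. -/
theorem exists_isHarmonic_of_isFlat (hne : M.boundary.Nonempty) {φ : V → ℝ} (hφ : M.IsFlat φ)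
    (U : M.boundary → ℝ)
    (hU : ∀ b : M.boundary, Tendsto φ (comap M.vtx (𝓝 (b : M.Compl))) (𝓝 (U b))) :
    ∃ u : C(M.Compl, ℝ), D.IsHarmonic u ∧ ∀ b : M.boundary, u b = U b := by
  obtain ⟨f, C, hC, hfE, hfU, hflux⟩ := D.exists_minimizer hne hφ U hU
  have huc := D.uniformContinuous_extend hC hfE
  let u : C(M.Compl, ℝ) := ⟨UniformSpace.Completion.extension (D.extend f),
    UniformSpace.Completion.continuous_extension⟩
  have hu : ∀ x : M.Point, u x = D.extend f x := fun x =>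
    UniformSpace.Completion.extension_coe huc x
  have huv : ∀ v, u (M.vtx v) = f v := fun v => hu _
  refine ⟨u, ⟨fun e t ht => ?_, fun v hv => ?_⟩, fun b => ?_⟩
  · simp only [huv]
    rw [hu, extend_edgePoint D f e ht]
  · simp only [huv]
    exact hflux v hv
  · have := comap_vtx_neBot b.2
    have h1 : Tendsto (fun v => u (M.vtx v)) (comap M.vtx (𝓝 (b : M.Compl))) (𝓝 (u b)) :=
      (u.continuous.tendsto _).comp tendsto_comap
    have h2 : Tendsto (fun v => (u (M.vtx v) - U b) ^ 2) (comap M.vtx (𝓝 (b : M.Compl)))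
        (𝓝 ((u b - U b) ^ 2)) := (h1.sub_const _).pow 2
    have h3 : Tendsto (fun v => C * dist (M.vtx v) (b : M.Compl)) (comap M.vtx (𝓝 (b : M.Compl)))
        (𝓝 0) := by
      simpa using ((tendsto_comap (f := M.vtx) (x := 𝓝 (b : M.Compl))).dist
        (tendsto_const_nhds (x := (b : M.Compl)))).const_mul C
    have h4 := le_of_tendsto_of_tendsto' h2 h3 fun v => by rw [huv]; exact hfU b v
    have h5 : u b - U b = 0 := pow_eq_zero_iff two_ne_zero |>.1 (le_antisymm h4 (sq_nonneg _))
    linarith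

end FundamentalData

/-! ### Density of the boundary values of flat functions -/

variable (M) in
/-- The algebra of boundary values of flat functions. -/
def flatAlgebra : Subalgebra ℝ C(M.boundary, ℝ) where
  carrier := {g | ∃ φ : V → ℝ, M.IsFlat φ ∧
    ∀ b : M.boundary, Tendsto φ (comap M.vtx (𝓝 (b : M.Compl))) (𝓝 (g b))}
  mul_mem' := by
    rintro g h ⟨φ, hφ, hg⟩ ⟨ψ, hψ, hh⟩
    exact ⟨_, hφ.op₂ hψ (· * ·), fun b => (hg b).mul (hh b)⟩
  add_mem' := by
    rintro g h ⟨φ, hφ, hg⟩ ⟨ψ, hψ, hh⟩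
    exact ⟨_, hφ.op₂ hψ (· + ·), fun b => (hg b).add (hh b)⟩
  algebraMap_mem' r := ⟨fun _ => r, isFlat_const r, fun b => tendsto_const_nhds⟩

/-- Ensures that the finite cut set of weak connectedness meets only finitely many edges. -/
theorem finite_edges_through (p : M.Point) :
    {e : M.Edge | ∃ t ∈ Icc 0 (M.len e), ((M.edgePoint e t : M.Point) : M.Compl) = p}.Finite := by
  have hd : ∀ (e : M.Edge) (t : ℝ), ((M.edgePoint e t : M.Point) : M.Compl) = p →
      dist (M.edgePoint e t) p = 0 := fun e t h => by
    rw [← UniformSpace.Completion.dist_eq, h, dist_self]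
  have hn := fun v y => dist_nonneg (x := (.vertex v : M.Point)) (y := y)
  rcases p with v | ⟨e', s, hs⟩
  · refine (finite_incident v).subset ?_
    rintro e ⟨t, ht, h⟩
    have h0 := hd e t h
    have hv : ∀ w, dist (.vertex w : M.Point) (.vertex v) ≤ 0 → v = w := fun w hw =>
      (vtx_injective (dist_le_zero.1 ((dist_vtx w v).le.trans hw))).symm
    rw [mem_incident_iff]
    rcases dist_edge_cases e ht (.vertex v) with ⟨t', ht', h1, -⟩ | h1 | h1
    · exact (edgePoint_eq_vertex ht' h1.symm).imp And.right And.right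
    · exact .inl (hv _ (by linarith [ht.1]))
    · exact .inr (hv _ (by linarith [ht.2]))
  · refine (finite_singleton e').subset ?_
    rintro e ⟨t, ht, h⟩
    have h0 := hd e t h
    rw [dist_comm, ← edgePoint_inner e' s hs] at h0
    rcases dist_edge_cases e' (Ioo_subset_Icc_self hs) (M.edgePoint e t) with
      ⟨t', ht', h1, h2⟩ | h1 | h1
    · rw [h0, abs_nonpos_iff, sub_eq_zero] at h2
      subst h2
      exact (edgePoint_eq_inner ht hs h1).1
    · linarith [hn (M.source e') (M.edgePoint e t), hs.1]
    · linarith [hn (M.target e') (M.edgePoint e t), hs.2]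

/-- The separating function is the indicator of `A`. A closed edge that misses `W` is connected,
hence lies wholly in `A` or in `B`; since only finitely many edges meet `W`, the indicator is flat
on the vertices. -/
theorem flatAlgebra_separatesPoints (hweak : M.WeaklyConnected) :
    (M.flatAlgebra).SeparatesPoints := by
  classical
  intro x y hxy
  obtain ⟨W, hWfin, hWG, A, B, hA, hB, hAB, hWAB, hxA, hyB⟩ :=
    hweak x y fun h => hxy (Subtype.ext h)
  -- The indicator is locally constant once only boundary points and vertices are considered. The
  -- delicate case is `b ∈ W`: then `b` is a boundary vertex, and no other such point is near it.
  have hloc : ∀ b ∈ M.boundary, ∀ᶠ z in 𝓝 b,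
      (z ∈ M.boundary ∨ z ∈ range M.vtx) → (z ∈ A ↔ b ∈ A) := by
    intro b hb
    by_cases hbW : b ∈ W
    · rcases hb with ⟨v, -, rfl⟩ | hb
      · obtain ⟨ε, hε, h1, h2⟩ := exists_nhd_compl (.vertex v : M.Point)
        filter_upwards [Metric.ball_mem_nhds _ hε] with z hz hz'
        have hz'' : z ∈ range M.vtx := by
          rcases hz' with (⟨w, -, rfl⟩ | hz') | hz'
          exacts [⟨w, rfl⟩, absurd (h1 z hz) hz', hz']
        obtain ⟨w, rfl⟩ := hz''
        rw [h2 w hz]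
        rfl
      · exact absurd (hWG hbW) hb
    · have hbAB : b ∈ A ∪ B := hWAB ▸ hbW
      rcases hbAB with h | h
      · filter_upwards [hA.mem_nhds h] with z hz _
        exact ⟨fun _ => h, fun _ => hz⟩
      · filter_upwards [hB.mem_nhds h] with z hz _
        exact ⟨fun h' => absurd hz (disjoint_left.1 hAB h'),
          fun h' => absurd h (disjoint_left.1 hAB h')⟩
  let χ : M.Compl → ℝ := fun z => if z ∈ A then 1 else 0
  have hχ : ∀ z z' : M.Compl, (z ∈ A ↔ z' ∈ A) → χ z = χ z' := fun z z' h => by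
    simp only [χ, h]
  have hcont : Continuous fun b : M.boundary => χ b := by
    refine IsLocallyConstant.continuous ((IsLocallyConstant.iff_eventually_eq _).2 fun b => ?_)
    filter_upwards [continuous_subtype_val.continuousAt.eventually (hloc b b.2)] with z hz
    exact hχ _ _ (hz (.inl z.2))
  refine ⟨fun b => χ b, ⟨⟨_, hcont⟩, ⟨fun v => χ (M.vtx v), ?_, fun b => ?_⟩, rfl⟩, ?_⟩
  · have hfin : (⋃ w ∈ W, {e : M.Edge | ∃ t ∈ Icc 0 (M.len e),
        ((M.edgePoint e t : M.Point) : M.Compl) = w}).Finite := by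
      refine hWfin.biUnion fun w hw => ?_
      obtain ⟨p, rfl⟩ := hWG hw
      exact finite_edges_through p
    refine hfin.subset fun e he => ?_
    by_contra hnot
    simp only [mem_iUnion, not_exists] at hnot
    set I := (fun t => ((M.edgePoint e t : M.Point) : M.Compl)) '' Icc 0 (M.len e)
    have hI : IsPreconnected I := isPreconnected_Icc.image _
      ((UniformSpace.Completion.continuous_coe _).comp (M.continuous_edgePoint e)).continuousOn
    have hIAB : I ⊆ A ∪ B := by
      rw [← hWAB]
      rintro _ ⟨t, ht, rfl⟩ hw
      exact hnot _ hw ⟨t, ht, rfl⟩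
    have hs : M.vtx (M.source e) ∈ I := ⟨0, zero_mem e, by simp only [edgePoint_zero]; rfl⟩
    have ht : M.vtx (M.target e) ∈ I := ⟨_, len_mem e, by simp only [edgePoint_len]; rfl⟩
    refine he (hχ _ _ ⟨fun h => ?_, fun h => ?_⟩)
    · exact hI.subset_left_of_subset_union hA hB hAB hIAB ⟨_, hs, h⟩ ht
    · exact hI.subset_left_of_subset_union hA hB hAB hIAB ⟨_, ht, h⟩ hs
  · refine tendsto_nhds_of_eventually_eq ?_
    filter_upwards [preimage_mem_comap (hloc b b.2)] with v hv
    exact hχ _ _ (hv (.inr ⟨v, rfl⟩))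
  · have hyA : (y : M.Compl) ∉ A := fun h => disjoint_left.1 hAB h hyB
    simp [χ, hxA, hyA]

/-- The Dirichlet problem for continuous boundary values. -/
theorem FundamentalData.exists_isHarmonic [CompactSpace M.Compl] (hweak : M.WeaklyConnected)
    (hne : M.boundary.Nonempty) (D : M.FundamentalData q) (U : C(M.boundary, ℝ)) :
    ∃ u : C(M.Compl, ℝ), D.IsHarmonic u ∧ ∀ b : M.boundary, u b = U b := by
  have : CompactSpace M.boundary := isCompact_iff_compactSpace.1 isClosed_boundary.isCompact
  let H := {u : C(M.Compl, ℝ) // D.IsHarmonic u}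
  have : CompleteSpace H := D.isClosed_isHarmonic.completeSpace_coe
  let R : H → C(M.boundary, ℝ) := fun u => u.1.restrict M.boundary
  have hR : UniformContinuous R := by
    refine (LipschitzWith.of_dist_le_mul (K := 1) fun u v => ?_).uniformContinuous
    rw [NNReal.coe_one, one_mul, ContinuousMap.dist_le dist_nonneg]
    exact fun b => ContinuousMap.dist_apply_le_dist (b : M.Compl)
  -- The maximum principle bounds the distance of two harmonic functions by that of their boundary
  -- values; with completeness, this closes the range.
  have hR' : AntilipschitzWith 1 R := by
    refine AntilipschitzWith.of_le_mul_dist fun u v => ?_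
    rw [NNReal.coe_one, one_mul, Subtype.dist_eq, ContinuousMap.dist_le dist_nonneg]
    intro x
    exact abs_sub_le_of_boundary hne D.integrableOn D.pos u.1.continuous v.1.continuous
      u.2.isQHarmonic v.2.isQHarmonic dist_nonneg
      (fun b hb => ContinuousMap.dist_apply_le_dist (f := R u) (g := R v) ⟨b, hb⟩) x
  have hcl : IsClosed (range R) := hR'.isClosed_range hR
  have hsub : (M.flatAlgebra : Set C(M.boundary, ℝ)) ⊆ range R := by
    rintro g ⟨φ, hφ, hg⟩
    obtain ⟨u, hu, hub⟩ := D.exists_isHarmonic_of_isFlat hne hφ g hg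
    exact ⟨⟨u, hu⟩, ContinuousMap.ext hub⟩
  have hU := ContinuousMap.continuousMap_mem_subalgebra_closure_of_separatesPoints M.flatAlgebra
    (flatAlgebra_separatesPoints hweak) U
  obtain ⟨u, hu⟩ := closure_minimal hsub hcl hU
  exact ⟨u.1, u.2, fun b => DFunLike.congr_fun hu b⟩

end MetricGraph

namespace MetricGraph

variable {V : Type*} {M : MetricGraph V} {q : M.Point → ℝ}

/-! ### The measure on the graph -/

/-- Separation of points is what the Lusin–Souslin argument in `measurableEmbedding_edgePoint`
needs; integrals then transfer to edges for integrands that are not known to be measurable. -/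
theorem eq_of_dist_eq_zero {x y : M.Point} (h : dist x y = 0) : x = y := by
  have key : ∀ (e : M.Edge) (t : ℝ) (ht : t ∈ Ioo 0 (M.len e)) (y : M.Point),
      dist (.inner e t ht) y = 0 → .inner e t ht = y := by
    intro e t ht y h
    have hn := fun v => dist_nonneg (x := (.vertex v : M.Point)) (y := y)
    rw [← edgePoint_inner e t ht] at h ⊢
    rcases dist_edge_cases e (Ioo_subset_Icc_self ht) y with ⟨s, -, h1, h2⟩ | h2 | h2
    · rw [h, abs_nonpos_iff, sub_eq_zero] at h2
      rw [h1, h2]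
    · linarith [hn (M.source e), ht.1]
    · linarith [hn (M.target e), ht.2]
  rcases x with v | ⟨e, t, ht⟩
  · rcases y with w | ⟨e, t, ht⟩
    · rw [vtx_injective (dist_eq_zero.1 ((dist_vtx v w).trans h))]
    · exact (key e t ht _ (by rwa [dist_comm])).symm
  · exact key e t ht y h

instance : T0Space M.Point :=
  ⟨fun _ _ h => eq_of_dist_eq_zero (Metric.inseparable_iff.1 h)⟩

variable (M) in
/-- The measure on a single edge. -/
noncomputable def edgeMeasure (e : M.Edge) : Measure M.Point :=
  (MeasureTheory.volume.restrict (Ioo 0 (M.len e))).map (M.edgePoint e)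

theorem volume_eq_sum : M.volume = Measure.sum M.edgeMeasure := rfl

theorem measurableEmbedding_edgePoint (e : M.Edge) :
    MeasurableEmbedding fun t : Ioo 0 (M.len e) => M.edgePoint e t := by
  have : PolishSpace (Ioo 0 (M.len e)) := isOpen_Ioo.polishSpace
  refine Continuous.measurableEmbedding
    ((M.continuous_edgePoint e).comp continuous_subtype_val) fun s t h => Subtype.ext ?_
  exact edgePoint_injOn e (Ioo_subset_Icc_self s.2) (Ioo_subset_Icc_self t.2) h

theorem edgeMeasure_eq (e : M.Edge) : M.edgeMeasure e =
    (Measure.comap ((↑) : Ioo 0 (M.len e) → ℝ) MeasureTheory.volume).map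
      fun t : Ioo 0 (M.len e) => M.edgePoint e t := by
  rw [edgeMeasure, ← map_comap_subtype_coe measurableSet_Ioo,
    Measure.map_map (M.continuous_edgePoint e).measurable measurable_subtype_coe]
  rfl

theorem integrable_edgeMeasure_iff {f : M.Point → ℝ} {e : M.Edge} :
    Integrable f (M.edgeMeasure e) ↔ IntegrableOn (M.onEdge f e) (Ioo 0 (M.len e)) := by
  rw [edgeMeasure_eq, (measurableEmbedding_edgePoint e).integrable_map_iff, IntegrableOn,
    ← map_comap_subtype_coe measurableSet_Ioo,
    (MeasurableEmbedding.subtype_coe measurableSet_Ioo).integrable_map_iff]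
  rfl

theorem integral_edgeMeasure (f : M.Point → ℝ) (e : M.Edge) :
    ∫ x, f x ∂M.edgeMeasure e = ∫ t in (0 : ℝ)..M.len e, M.onEdge f e t := by
  rw [intervalIntegral.integral_of_le (M.len_pos e).le, integral_Ioc_eq_integral_Ioo,
    edgeMeasure_eq, (measurableEmbedding_edgePoint e).integral_map,
    ← map_comap_subtype_coe measurableSet_Ioo,
    (MeasurableEmbedding.subtype_coe measurableSet_Ioo).integral_map]
  rfl

theorem integrableOn_onEdge {f : M.Point → ℝ} (hf : Integrable f M.volume) (e : M.Edge) :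
    IntegrableOn (M.onEdge f e) (Ioo 0 (M.len e)) :=
  integrable_edgeMeasure_iff.1 (hf.mono_measure (Measure.le_sum _ e))

theorem hasSum_integral_onEdge {f : M.Point → ℝ} (hf : Integrable f M.volume) :
    HasSum (fun e => ∫ t in (0 : ℝ)..M.len e, M.onEdge f e t) (∫ x, f x ∂M.volume) := by
  simp_rw [← integral_edgeMeasure]
  exact hasSum_integral_measure hf

theorem nonempty_fundamentalData (hq0 : ∀ x, 0 < q x) (hq : Integrable q M.volume) :
    Nonempty (M.FundamentalData q) := by
  choose h₁ p₁ h₂ p₂ h using fun e => exists_isFundamental (M.len_pos e)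
    (integrableOn_onEdge hq e) fun t => (hq0 (M.edgePoint e t)).le
  exact ⟨⟨h₁, p₁, h₂, p₂, hq0, integrableOn_onEdge hq, (hasSum_integral_onEdge hq).summable, h⟩⟩

/-! ### Eventually flat functions -/

namespace EventuallyFlat

variable {φ : M.Compl → ℝ}

theorem continuous_onEdge (hφ : M.EventuallyFlat φ) (e : M.Edge) :
    Continuous (M.onEdge (fun x : M.Point => φ x) e) :=
  hφ.continuous.comp ((UniformSpace.Completion.continuous_coe _).comp (M.continuous_edgePoint e))

theorem differentiableOn_onEdge (hφ : M.EventuallyFlat φ) (e : M.Edge) :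
    DifferentiableOn ℝ (M.onEdge (fun x : M.Point => φ x) e) (Ioo 0 (M.len e)) :=
  (hφ.smooth e).differentiableOn (by simp)

theorem onEdge_eq_of_deriv_eq_zero (hφ : M.EventuallyFlat φ) (e : M.Edge) {s t : ℝ} (hs : 0 ≤ s)
    (hst : s < t) (ht : t ≤ M.len e)
    (h : ∀ x ∈ Ioo s t, deriv (M.onEdge (fun x : M.Point => φ x) e) x = 0) :
    M.onEdge (fun x : M.Point => φ x) e t = M.onEdge (fun x : M.Point => φ x) e s := by
  obtain ⟨c, hc, hslope⟩ := exists_deriv_eq_slope (M.onEdge (fun x : M.Point => φ x) e) hst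
    (hφ.continuous_onEdge e).continuousOn
    ((hφ.differentiableOn_onEdge e).mono (Ioo_subset_Ioo hs ht))
  rw [h c hc, eq_comm, div_eq_zero_iff] at hslope
  rcases hslope with h1 | h1 <;> linarith

theorem onEdge_of_nonpos (e : M.Edge) {t : ℝ} (ht : t ≤ 0) :
    M.onEdge (fun x : M.Point => φ x) e t = M.onEdge (fun x : M.Point => φ x) e 0 := by
  simp [onEdge, edgePoint, ht]

theorem onEdge_of_len_le (e : M.Edge) {t : ℝ} (ht : M.len e ≤ t) :
    M.onEdge (fun x : M.Point => φ x) e t = M.onEdge (fun x : M.Point => φ x) e (M.len e) := by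
  have h1 := M.len_pos e
  simp [onEdge, edgePoint, ht, not_le.2 h1, not_le.2 (h1.trans_le ht)]

theorem eventually_eq_source (hφ : M.EventuallyFlat φ) (e : M.Edge) :
    M.onEdge (fun x : M.Point => φ x) e =ᶠ[𝓝 0]
      fun _ => M.onEdge (fun x : M.Point => φ x) e 0 := by
  obtain ⟨δ, hδ, h⟩ := mem_nhdsGT_iff_exists_Ioo_subset.1 (hφ.flat_source e)
  filter_upwards [Iio_mem_nhds (lt_min hδ (M.len_pos e))] with t ht
  rw [mem_Iio, lt_min_iff] at ht
  rcases le_or_gt t 0 with h0 | h0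
  · exact onEdge_of_nonpos e h0
  · exact hφ.onEdge_eq_of_deriv_eq_zero e le_rfl h0 ht.2.le fun x hx =>
      h ⟨hx.1, hx.2.trans ht.1⟩

theorem eventually_eq_target (hφ : M.EventuallyFlat φ) (e : M.Edge) :
    M.onEdge (fun x : M.Point => φ x) e =ᶠ[𝓝 (M.len e)]
      fun _ => M.onEdge (fun x : M.Point => φ x) e (M.len e) := by
  obtain ⟨δ, hδ, h⟩ := mem_nhdsLT_iff_exists_Ioo_subset.1 (hφ.flat_target e)
  filter_upwards [Ioi_mem_nhds (max_lt hδ (M.len_pos e))] with t ht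
  rw [mem_Ioi, max_lt_iff] at ht
  rcases le_or_gt (M.len e) t with h0 | h0
  · exact onEdge_of_len_le e h0
  · exact (hφ.onEdge_eq_of_deriv_eq_zero e ht.2.le h0 le_rfl fun x hx =>
      h ⟨ht.1.trans hx.1, hx.2⟩).symm

/-- The clamped parameter continues `φ` by constants beyond both ends, and flatness near the ends
makes the gluing smooth. Ordinary two-sided derivatives can thus be used up to the ends, where they
vanish. -/
theorem contDiff_onEdge (hφ : M.EventuallyFlat φ) (e : M.Edge) :
    ContDiff ℝ (⊤ : ℕ∞) (M.onEdge (fun x : M.Point => φ x) e) := by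
  rw [contDiff_iff_contDiffAt]
  intro t
  rcases lt_trichotomy t 0 with h | rfl | h
  · refine (contDiffAt_const (c := M.onEdge (fun x : M.Point => φ x) e 0)).congr_of_eventuallyEq ?_
    filter_upwards [Iio_mem_nhds h] with s hs
    exact onEdge_of_nonpos e (le_of_lt hs)
  · exact contDiffAt_const.congr_of_eventuallyEq (hφ.eventually_eq_source e)
  rcases lt_trichotomy t (M.len e) with h' | rfl | h'
  · exact (hφ.smooth e).contDiffAt (Ioo_mem_nhds h h')
  · exact contDiffAt_const.congr_of_eventuallyEq (hφ.eventually_eq_target e)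
  · refine (contDiffAt_const
      (c := M.onEdge (fun x : M.Point => φ x) e (M.len e))).congr_of_eventuallyEq ?_
    filter_upwards [Ioi_mem_nhds h'] with s hs
    exact onEdge_of_len_le e (le_of_lt hs)

theorem contDiff_deriv (hφ : M.EventuallyFlat φ) (e : M.Edge) :
    ContDiff ℝ 1 (deriv (M.onEdge (fun x : M.Point => φ x) e)) := by
  have h : ContDiff ℝ (1 + 1) (M.onEdge (fun x : M.Point => φ x) e) :=
    (hφ.contDiff_onEdge e).of_le (by norm_cast)
  exact (contDiff_succ_iff_deriv.1 h).2.2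

theorem deriv_zero (hφ : M.EventuallyFlat φ) (e : M.Edge) :
    deriv (M.onEdge (fun x : M.Point => φ x) e) 0 = 0 := by
  rw [(hφ.eventually_eq_source e).deriv_eq, deriv_const]

theorem deriv_len (hφ : M.EventuallyFlat φ) (e : M.Edge) :
    deriv (M.onEdge (fun x : M.Point => φ x) e) (M.len e) = 0 := by
  rw [(hφ.eventually_eq_target e).deriv_eq, deriv_const]

theorem onEdge_secondDeriv (e : M.Edge) {t : ℝ} (ht : t ∈ Ioo 0 (M.len e)) :
    M.onEdge (M.secondDeriv fun x : M.Point => φ x) e t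
      = deriv (deriv (M.onEdge (fun x : M.Point => φ x) e)) t := by
  unfold onEdge
  rw [edgePoint_inner e t ht]
  rfl

theorem integrable_secondDeriv [Countable V] (hφ : M.EventuallyFlat φ) :
    Integrable (M.secondDeriv fun x : M.Point => φ x) M.volume := by
  have hcount : Countable M.Edge := by
    have : Countable (Sym2 V) := Quot.mk_surjective.countable
    infer_instance
  rw [volume_eq_sum]
  refine integrable_sum_measure (fun e => ?_) ?_
  · rw [integrable_edgeMeasure_iff]
    have hc : Continuous (deriv (deriv (M.onEdge (fun x : M.Point => φ x) e))) :=
      (hφ.contDiff_deriv e).continuous_deriv le_rfl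
    refine IntegrableOn.congr_fun (hc.integrableOn_Icc.mono_set Ioo_subset_Icc_self)
      (fun t ht => (onEdge_secondDeriv e ht).symm) measurableSet_Ioo
  · obtain ⟨S, hS, hflat⟩ := hφ.flat
    refine summable_of_hasFiniteSupport (hS.subset fun e he => ?_)
    by_contra heS
    refine he ?_
    simp only [integral_edgeMeasure]
    have : ∀ t ∈ Ioo 0 (M.len e), M.onEdge
        (fun x => ‖M.secondDeriv (fun x : M.Point => φ x) x‖) e t = 0 := by
      intro t ht
      change ‖M.onEdge (M.secondDeriv fun x : M.Point => φ x) e t‖ = 0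
      rw [onEdge_secondDeriv e ht, norm_eq_zero]
      have h1 : deriv (M.onEdge (fun x : M.Point => φ x) e) =ᶠ[𝓝 t] fun _ => 0 := by
        filter_upwards [isOpen_Ioo.mem_nhds ht] with s hs
        exact hflat e heS s hs
      rw [h1.deriv_eq, deriv_const]
    rw [intervalIntegral_congr_Ioo (M.len_pos e).le (g := fun _ => 0)
      ((ae_restrict_mem measurableSet_Ioo).mono this)]
    simp

theorem isFlat (hφ : M.EventuallyFlat φ) : M.IsFlat fun v => φ (M.vtx v) := by
  obtain ⟨S, hS, hflat⟩ := hφ.flat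
  refine hS.subset fun e he => ?_
  by_contra heS
  have := hφ.onEdge_eq_of_deriv_eq_zero e le_rfl (M.len_pos e) le_rfl (hflat e heS)
  unfold onEdge at this
  rw [edgePoint_zero, edgePoint_len] at this
  exact he this.symm

/-- Infinitely many such vertices would accumulate in the compact completion. The limit is not in
the graph, where vertices are isolated, so `φ = 1` there; but `φ` takes finitely many values on
vertices, so values other than 1 stay away from 1. -/
theorem finite_ne_one [CompactSpace M.Compl] (hφ : M.EventuallyFlat φ)
    (h1 : ∀ b ∈ M.boundary, φ b = 1) : {v | φ (M.vtx v) ≠ 1}.Finite := by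
  by_contra hinf
  obtain ⟨b, hb⟩ := (Set.Infinite.image (vtx_injective (M := M)).injOn
    hinf).exists_accPt_principal
  rw [accPt_iff_frequently] at hb
  by_cases hbG : b ∈ range ((↑) : M.Point → M.Compl)
  · obtain ⟨p, rfl⟩ := hbG
    obtain ⟨ε, hε, -, h2⟩ := exists_nhd_compl p
    obtain ⟨_, ⟨hne, v, -, rfl⟩, hv⟩ := (hb.and_eventually (Metric.ball_mem_nhds _ hε)).exists
    exact hne (by rw [h2 v hv]; rfl)
  · have hF : IsClosed (range (fun v => φ (M.vtx v)) \ {1}) :=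
      (hφ.isFlat.finite_range.subset sdiff_subset).isClosed
    have hbF : φ b ∈ (range (fun v => φ (M.vtx v)) \ {1})ᶜ := fun h => h.2 (h1 b (.inr hbG))
    have := hφ.continuous.continuousAt.eventually (hF.isOpen_compl.mem_nhds hbF)
    obtain ⟨_, ⟨-, v, hv, rfl⟩, hv'⟩ := (hb.and_eventually this).exists
    exact hv' ⟨⟨v, rfl⟩, hv⟩

/-- Integration by parts on an edge. -/
theorem integral_edge (hφ : M.EventuallyFlat φ) (hq : Integrable q M.volume) {u : M.Point → ℝ}
    (hu : M.IsQHarmonic q u) (e : M.Edge) :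
    ∫ t in (0 : ℝ)..M.len e, M.onEdge
      (fun x => u x * (-M.secondDeriv (fun x : M.Point => φ x) x + q x * (φ x - 1))) e t
    = M.edgeDeriv u e (M.len e) * (φ (M.vtx (M.target e)) - 1)
      - M.edgeDeriv u e 0 * (φ (M.vtx (M.source e)) - 1) := by
  have hl := (M.len_pos e).le
  set g := M.onEdge (fun x : M.Point => φ x) e with hg
  have hsol := hu.isSol e
  have hg0 : g 0 = φ (M.vtx (M.source e)) := by simp only [hg, onEdge, edgePoint_zero]; rfl
  have hgl : g (M.len e) = φ (M.vtx (M.target e)) := by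
    simp only [hg, onEdge, edgePoint_len]; rfl
  have hg1 : Continuous (deriv g) := (hφ.contDiff_deriv e).continuous
  have hg2 : Continuous (deriv (deriv g)) := (hφ.contDiff_deriv e).continuous_deriv le_rfl
  have hgd : ∀ t, HasDerivAt g (deriv g t) t := fun t =>
    ((hφ.contDiff_onEdge e).differentiable (by simp) t).hasDerivAt
  have hgd2 : ∀ t, HasDerivAt (deriv g) (deriv (deriv g) t) t := fun t =>
    ((hφ.contDiff_deriv e).differentiable (by simp) t).hasDerivAt
  -- `e1` integrates `φ'' u` and has no boundary terms since `φ' = 0` at both ends; `e2` integrates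
  -- `u'' (φ - 1)`. In the difference the terms `u' φ'` cancel.
  have e1 := integral_by_parts_of_ac hl (p := deriv g) (r := deriv (deriv g))
    (hφ.contDiff_deriv e).contDiffOn.absolutelyContinuousOnInterval
    (Eventually.of_forall hgd2) hsol.hasDeriv (hsol.continuousOn_deriv hl)
  have e2 := integral_by_parts_of_ac hl hsol.ac hsol.eqn (g := fun t => g t - 1) (g' := deriv g)
    (fun t _ => ((hgd t).sub_const 1).hasDerivWithinAt) hg1.continuousOn
  rw [hφ.deriv_zero, hφ.deriv_len, zero_mul, zero_mul, sub_zero] at e1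
  refine Eq.trans ?_ ((congrArg₂ (· - ·) e2 e1).trans (by rw [sub_zero, hg0, hgl]))
  rw [← intervalIntegral.integral_sub]
  · refine intervalIntegral_congr_Ioo hl ?_
    filter_upwards [ae_restrict_mem measurableSet_Ioo] with t ht
    change M.onEdge u e t * (-M.onEdge (M.secondDeriv fun x : M.Point => φ x) e t
      + M.onEdge q e t * (g t - 1)) = _
    rw [onEdge_secondDeriv e ht]
    ring
  · have h1 : IntervalIntegrable (fun t => M.onEdge q e t * (M.onEdge u e t * (g t - 1)))
        MeasureTheory.volume 0
        (M.len e) := IsSol.intervalIntegrable_mul hl (integrableOn_onEdge hq e)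
      (f := fun t => M.onEdge u e t * (g t - 1))
      (hsol.continuousOn.mul ((hφ.continuous_onEdge e).sub continuous_const).continuousOn)
      le_rfl hl le_rfl
    simp only [← mul_assoc] at h1
    refine h1.add (ContinuousOn.intervalIntegrable ?_)
    rw [uIcc_of_le hl]
    exact (hsol.continuousOn_deriv hl).mul hg1.continuousOn
  · refine ContinuousOn.intervalIntegrable ?_
    rw [uIcc_of_le hl]
    exact (hg2.continuousOn.mul hsol.continuousOn).add
      (hg1.continuousOn.mul (hsol.continuousOn_deriv hl))

/-- Green's formula on the graph. -/
theorem hasSum_edge [CompactSpace M.Compl] (hne : M.boundary.Nonempty) (hφ : M.EventuallyFlat φ)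
    (h1 : ∀ b ∈ M.boundary, φ b = 1) {u : M.Point → ℝ} (hu : M.IsQHarmonic q u) :
    HasSum (fun e => M.edgeDeriv u e (M.len e) * (φ (M.vtx (M.target e)) - 1)
      - M.edgeDeriv u e 0 * (φ (M.vtx (M.source e)) - 1)) 0 := by
  classical
  set T := (hφ.finite_ne_one h1).toFinset
  have hT : ∀ v, v ∉ T → φ (M.vtx v) - 1 = 0 := fun v hv =>
    sub_eq_zero.2 (not_not.1 fun h => hv ((hφ.finite_ne_one h1).mem_toFinset.2 h))
  -- Regroup the end terms by vertex. As `T` is finite, sums over edges and vertices can be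
  -- exchanged without any summability of the derivatives of `u`.
  have hterm : ∀ e, M.edgeDeriv u e (M.len e) * (φ (M.vtx (M.target e)) - 1)
      - M.edgeDeriv u e 0 * (φ (M.vtx (M.source e)) - 1)
      = ∑ v ∈ T, if e ∈ M.incident v then -((φ (M.vtx v) - 1) * M.outwardDeriv u v e) else 0 := by
    intro e
    have hsplit : ∀ v, (if e ∈ M.incident v then
        -((φ (M.vtx v) - 1) * M.outwardDeriv u v e) else 0) =
        (if M.target e = v then M.edgeDeriv u e (M.len e) * (φ (M.vtx v) - 1) else 0)
        + (if M.source e = v then -(M.edgeDeriv u e 0 * (φ (M.vtx v) - 1)) else 0) := by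
      intro v
      rw [mem_incident_iff]
      unfold outwardDeriv
      by_cases hs : v = M.source e
      · subst hs
        simp [(source_ne_target e).symm, mul_comm]
      · by_cases ht : v = M.target e
        · subst ht
          simp [source_ne_target e, (source_ne_target e).symm, mul_comm]
        · simp [hs, ht, Ne.symm hs, Ne.symm ht]
    simp_rw [hsplit]
    rw [Finset.sum_add_distrib, Finset.sum_ite_eq, Finset.sum_ite_eq, sub_eq_add_neg]
    congr 1
    · split_ifs with h
      · rfl
      · rw [hT _ h, mul_zero]
    · split_ifs with h
      · rfl
      · rw [hT _ h, mul_zero, neg_zero]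
  simp_rw [hterm]
  suffices h : ∀ v ∈ T, HasSum (fun e => if e ∈ M.incident v then
      -((φ (M.vtx v) - 1) * M.outwardDeriv u v e) else 0) 0 by
    simpa only [Finset.sum_const_zero] using hasSum_sum h
  intro v hv
  -- Vertices of `T` are off the boundary, where `φ = 1`, so the vertex condition is available.
  have hvb : M.vtx v ∉ M.boundary := fun hb => (hφ.finite_ne_one h1).mem_toFinset.1 hv (h1 _ hb)
  have h0 := hu.sum_outwardDeriv (two_le_ncard_incident hne hvb)
  have hsum : ∑ e ∈ (finite_incident v).toFinset, (if e ∈ M.incident v then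
      -((φ (M.vtx v) - 1) * M.outwardDeriv u v e) else 0) = 0 := by
    rw [← neg_zero, ← mul_zero (φ (M.vtx v) - 1), ← h0, Finset.mul_sum, ← Finset.sum_neg_distrib]
    exact Finset.sum_congr rfl fun e he => if_pos ((finite_incident v).mem_toFinset.1 he)
  have := hasSum_sum_of_ne_finset_zero (L := .unconditional _)
    (s := (finite_incident (M := M) v).toFinset) (f := fun e => if e ∈ M.incident v then
      -((φ (M.vtx v) - 1) * M.outwardDeriv u v e) else 0) fun e he =>
    if_neg fun h => he ((finite_incident v).mem_toFinset.2 h)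
  rwa [hsum] at this

end EventuallyFlat

/-! ### The Dirichlet–Neumann function -/

theorem integrable_mul_of_continuous [CompactSpace M.Compl] {u : M.Compl → ℝ} (hu : Continuous u)
    {f : M.Point → ℝ} (hf : Integrable f M.volume) :
    Integrable (fun x : M.Point => u x * f x) M.volume := by
  obtain ⟨B, hB⟩ := isCompact_univ.exists_bound_of_continuousOn hu.continuousOn
  exact hf.bdd_mul (hu.comp (UniformSpace.Completion.continuous_coe _)).aestronglyMeasurable
    (Eventually.of_forall fun x => hB x (mem_univ _))

/-- For `φ = 1` this is immediate, but the test function in the definition is an arbitrary choice;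
Green's formula removes the extra term for every admissible `φ`. -/
theorem integral_mul_L_eq [Countable V] [CompactSpace M.Compl] (hne : M.boundary.Nonempty)
    (hq : Integrable q M.volume) {u φ : M.Compl → ℝ} (huc : Continuous u)
    (hu : M.IsQHarmonic q fun x : M.Point => u x) (hφ : M.EventuallyFlat φ)
    (h1 : ∀ b ∈ M.boundary, φ b = 1) :
    ∫ x : M.Point, u x * M.L q (fun y => φ y) x ∂M.volume = ∫ x : M.Point, u x * q x ∂M.volume := by
  have hG : Integrable (fun x : M.Point =>
      u x * (-M.secondDeriv (fun x : M.Point => φ x) x + q x * (φ x - 1))) M.volume := by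
    refine integrable_mul_of_continuous huc (hφ.integrable_secondDeriv.neg.add ?_)
    have := integrable_mul_of_continuous (u := fun x => φ x - 1)
      (hφ.continuous.sub continuous_const) hq
    simpa only [mul_comm] using this
  have hG0 := (hasSum_integral_onEdge hG).unique
    (by simpa only [hφ.integral_edge hq hu] using hφ.hasSum_edge hne h1 hu)
  have hsplit : ∀ x : M.Point, u x * M.L q (fun y => φ y) x = u x * q x +
      u x * (-M.secondDeriv (fun x : M.Point => φ x) x + q x * (φ x - 1)) := fun x => by
    unfold L
    ring
  simp_rw [hsplit]
  rw [integral_add (integrable_mul_of_continuous huc hq) hG, hG0, add_zero]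

theorem IsQHarmonicExtension.unique [CompactSpace M.Compl] (hne : M.boundary.Nonempty)
    (hq0 : ∀ x, 0 < q x) (hq : Integrable q M.volume) {U : M.boundary → ℝ} {u v : M.Compl → ℝ}
    (hu : M.IsQHarmonicExtension q U u) (hv : M.IsQHarmonicExtension q U v) : u = v := by
  funext x
  have := abs_sub_le_of_boundary hne (integrableOn_onEdge hq) hq0 hu.continuous hv.continuous
    hu.isQHarmonic hv.isQHarmonic le_rfl (fun b hb => by
      rw [hu.boundaryValue ⟨b, hb⟩, hv.boundaryValue ⟨b, hb⟩, sub_self, abs_zero]) x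
  exact sub_eq_zero.1 (abs_nonpos_iff.1 this)

theorem isTestFunction_one : M.IsTestFunction univ fun _ => 1 where
  eventuallyFlat :=
    { continuous := continuous_const
      smooth := fun _ => contDiffOn_const
      flat := ⟨∅, finite_empty, fun _ _ t _ => deriv_const t 1⟩
      flat_source := fun _ => Eventually.of_forall fun t => deriv_const t 1
      flat_target := fun _ => Eventually.of_forall fun t => deriv_const t 1 }
  eq_one _ _ := rfl
  eq_zero b hb := absurd (mem_univ b) hb

/-- The constant 1 shows that the default value 0 is not taken. -/
theorem isTestFunction_testFunction : M.IsTestFunction univ (M.testFunction univ) := by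
  have h : ∃ φ, M.IsTestFunction univ φ := ⟨_, isTestFunction_one⟩
  unfold testFunction
  rw [dif_pos h]
  exact h.choose_spec

/-- The point where `u > 0` may lie outside the graph, so positivity is propagated by contradiction:
a zero integral gives `u = 0` almost everywhere on each edge, then everywhere on the graph by
continuity, then on the completion by density. -/
theorem integral_mul_pos [CompactSpace M.Compl] (hq0 : ∀ x, 0 < q x) (hq : Integrable q M.volume)
    {u : M.Compl → ℝ} (huc : Continuous u) (hu0 : ∀ x, 0 ≤ u x) {b : M.Compl}
    (hb : b ∈ M.boundary) (hub : 0 < u b) : 0 < ∫ x : M.Point, u x * q x ∂M.volume := by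
  have hnn : ∀ x : M.Point, 0 ≤ u x * q x := fun x => mul_nonneg (hu0 x) (hq0 x).le
  refine (integral_nonneg hnn).lt_of_ne fun h => ?_
  have hae := (integral_eq_zero_iff_of_nonneg hnn (integrable_mul_of_continuous huc hq)).1 h.symm
  have hedge : ∀ (e : M.Edge), ∀ t ∈ Icc 0 (M.len e), u (M.edgePoint e t : M.Point) = 0 := by
    intro e
    have h1 : ∀ᵐ x : M.Point ∂M.edgeMeasure e, u x * q x = 0 :=
      (Measure.le_sum M.edgeMeasure e).absolutelyContinuous.ae_le hae
    have h2 := ae_of_ae_map (M.continuous_edgePoint e).aemeasurable h1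
    rw [restrict_Ioo_eq_restrict_Ioc, restrict_Ioc_eq_restrict_Icc] at h2
    have h3 : (fun t => u (M.edgePoint e t : M.Point))
        =ᵐ[MeasureTheory.volume.restrict (Icc 0 (M.len e))] fun _ => (0 : ℝ) := by
      filter_upwards [h2] with t ht
      exact (mul_eq_zero.1 ht).resolve_right (hq0 _).ne'
    have hc : Continuous fun t => u (M.edgePoint e t : M.Point) :=
      huc.comp ((UniformSpace.Completion.continuous_coe _).comp (M.continuous_edgePoint e))
    exact Measure.eqOn_Icc_of_ae_eq MeasureTheory.volume (M.len_pos e).ne h3 hc.continuousOn continuousOn_const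
  have hpt : ∀ x : M.Point, u x = 0 := by
    rintro (v | ⟨e, t, ht⟩)
    · obtain ⟨e, he⟩ := incident_nonempty ⟨b, hb⟩ v
      rcases mem_incident_iff.1 he with rfl | rfl
      · rw [← edgePoint_zero]
        exact hedge e 0 (zero_mem e)
      · rw [← edgePoint_len]
        exact hedge e _ (len_mem e)
    · rw [← edgePoint_inner]
      exact hedge e t (Ioo_subset_Icc_self ht)
  have hall : u = fun _ => 0 :=
    UniformSpace.Completion.denseRange_coe.equalizer huc continuous_const (funext hpt)
  rw [hall] at hub
  exact lt_irrefl _ hub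

end MetricGraph

/-! ### The proposition -/

theorem mainTheorem10 {V : Type*} [Countable V] (M : MetricGraph V)
    (hcompact : CompactSpace M.Compl) (hweak : M.WeaklyConnected)
    (q : M.Point → ℝ) (hq_pos : ∀ x, 0 < q x) (hq_int : Integrable q M.volume)
    (ω : M.Edge → ℝ) (hω_pos : ∀ e, 0 < ω e) (hω_sum : Summable ω)
    (hqω : Integrable (fun x => ((M.edgeConst ω x)⁻¹ * q x) ^ 2 * M.edgeConst ω x) M.volume)
    (U : M.boundary → ℝ) (hU_cont : Continuous U) (hU_nonneg : ∀ b, 0 ≤ U b)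
    (hU_pos : ∃ b, 0 < U b) :
    (∃ u, M.IsQHarmonicExtension q U u) ∧
    ∀ u, M.IsQHarmonicExtension q U u →
      Integrable (fun x : M.Point => u x * q x) M.volume ∧
      M.dirichletNeumann q U univ = ∫ x : M.Point, u x * q x ∂M.volume ∧
      0 < ∫ x : M.Point, u x * q x ∂M.volume := by
  obtain ⟨b, hb⟩ := hU_pos
  have hne : M.boundary.Nonempty := ⟨b, b.2⟩
  obtain ⟨D⟩ := MetricGraph.nonempty_fundamentalData hq_pos hq_int
  have hex : ∃ u, M.IsQHarmonicExtension q U u := by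
    obtain ⟨u, hu, hub⟩ := D.exists_isHarmonic hweak hne ⟨U, hU_cont⟩
    exact ⟨u, u.continuous, hu.isQHarmonic, hub⟩
  refine ⟨hex, fun u hu => ⟨MetricGraph.integrable_mul_of_continuous hu.continuous hq_int, ?_, ?_⟩⟩
  -- Uniqueness identifies the chosen extension with the given `u`.
  · have hext : M.qHarmonicExtension q U = u := by
      unfold MetricGraph.qHarmonicExtension
      rw [dif_pos hex]
      exact hex.choose_spec.unique hne hq_pos hq_int hu
    unfold MetricGraph.dirichletNeumann
    rw [hext]
    have hφ := MetricGraph.isTestFunction_testFunction (M := M)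
    exact MetricGraph.integral_mul_L_eq hne hq_int hu.continuous hu.isQHarmonic hφ.eventuallyFlat
      fun b hb => hφ.eq_one ⟨b, hb⟩ (mem_univ _)
  · refine MetricGraph.integral_mul_pos hq_pos hq_int hu.continuous (fun x => ?_) b.2
      (by rwa [hu.boundaryValue])
    -- The maximum principle for `-u` with bound 0 gives `u ≥ 0`; the summand `0 * u x` only fits
    -- `-u` to the form of `comb`.
    have := MetricGraph.le_of_le_boundary hne (MetricGraph.integrableOn_onEdge hq_int) hq_pos
      (u := fun x => -1 * u x + 0 * u x) (by have := hu.continuous; fun_prop)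
      (hu.isQHarmonic.comb hu.isQHarmonic (-1) 0)
      le_rfl (fun c hc => by
        have h1 := hU_nonneg ⟨c, hc⟩
        have h2 := hu.boundaryValue ⟨c, hc⟩
        simp only at h2
        linarith) x
    linarith
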